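/- For $\lambda=(p,\theta)\in\Phi=\mathbb R\times\mathbb R$ let $e_\lambda(x)=2^{1/4}\exp\left(-\pi(x-p)^2+2\pi i\theta x\right)$, let $\langle\cdot|\cdot\rangle$ and $\|\cdot\|$ be the scalar product and the norm of $L_2(\mathbb R)$, and give $\Phi$ the Euclidean norm $|\lambda|^2=p^2+\theta^2$ and Lebesgue measure. For $\delta>1$ let $H^\delta$ be the space of all $f\in L_2(\mathbb R)$ with $$\|f\|_\delta=\left(\int_\Phi\left(|\lambda|^\delta+1\right)|\langle f|e_\lambda\rangle|^2\,d\lambda\right)^{1/2}<\infty ,$$ and let $H=\bigcup_{\delta>1}H^\delta$. Put $\Lambda=\mathbb Z\times\mathbb Z\subset\Phi$ and $\sharp=(1/2,1/2)$. Theorem (a `certainty' theorem). There are a number $r_0>0$ and, for each $\delta>1$, a constant $C_\delta$ such that the following holds. Let $K\subset\Phi$ be a bounded domain (a non-empty, open, connected, bounded set), let $r\ge r_0$, and let $D=\{\mu\in\Phi:\operatorname{dist}(\mu,K)<r\}$ be the $r$-neighborhood of $K$. Every $f\in H$ can be written in the form $$f=\sum_{\lambda\in\Lambda\cap D}\alpha^\lambda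 e_\lambda+\sum_{\mu\in(\Lambda+\sharp)\cap(D\setminus K)}\omega^\mu e_\mu+\varphi_r$$ with complex coefficients $\alpha^\lambda,\omega^\mu$ (both sums are finite) and $\varphi_r\in L_2(\mathbb R)$ such that, for every $\delta>1$ with $f\in H^\delta$, $$\|\varphi_r\|\le\left(\int_{\Phi\setminus D}|\langle f|e_\mu\rangle|^2\,d\mu\right)^{1/2}+C_\delta\,r^\delta e^{-r/e}\,\|f\|_\delta .$$ In particular, $r_0$ is an absolute constant and $C_\delta$ depends only on $\delta$, not on $K$, $D$, $r$ or $f$. -/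

import Mathlib

open MeasureTheory

noncomputable section

namespace Gabor

/-- The phase plane `ℝ × ℝ'`. The point `(p, θ)` is the complex number `p + iθ`, so that the norm
is the Euclidean one, `|(p, θ)|² = p² + θ²`, and `volume` is the Lebesgue measure `dp dθ`. -/
abbrev Phase : Type := ℂ

/-- The Hilbert space `L₂(ℝ)` of complex valued functions. -/
abbrev L2 : Type := Lp ℂ 2 (volume : Measure ℝ)

/-- The Gabor function `2^{1/4} exp(-π (x - p)² + 2πi θ x)` at the point `z = (p, θ)`. -/
def gaborFun (z : Phase) (x : ℝ) : ℂ :=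
  ((2 : ℝ) ^ (1 / 4 : ℝ) : ℝ) *
    Complex.exp (-(Real.pi : ℂ) * ((x : ℂ) - z.re) ^ 2 + 2 * Real.pi * Complex.I * z.im * x)

theorem norm_gaborFun (z : Phase) (x : ℝ) :
    ‖gaborFun z x‖ = (2 : ℝ) ^ (1 / 4 : ℝ) * Real.exp (-Real.pi * (x - z.re) ^ 2) := by
  have h : (-(Real.pi : ℂ) * ((x : ℂ) - z.re) ^ 2 + 2 * Real.pi * Complex.I * z.im * x)
      = ((-Real.pi * (x - z.re) ^ 2 : ℝ) : ℂ) + ((2 * Real.pi * z.im * x : ℝ) : ℂ) * Complex.I := by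
    push_cast; ring
  rw [gaborFun, h, norm_mul, Complex.norm_exp, Complex.norm_real,
    Real.norm_of_nonneg (by positivity), Complex.add_re, Complex.ofReal_re, Complex.re_ofReal_mul,
    Complex.I_re, mul_zero, add_zero]

theorem memLp_gaborFun (z : Phase) : MemLp (gaborFun z) 2 (volume : Measure ℝ) := by
  have hc : Continuous (gaborFun z) := by unfold gaborFun; fun_prop
  rw [memLp_two_iff_integrable_sq_norm hc.aestronglyMeasurable]
  have h := ((integrable_exp_neg_mul_sq (b := 2 * Real.pi) (by positivity)).comp_sub_right
    z.re).const_mul (((2 : ℝ) ^ (1 / 4 : ℝ)) ^ 2)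
  refine h.congr (Filter.Eventually.of_forall fun x => ?_)
  simp only [norm_gaborFun, mul_pow, ← Real.exp_nat_mul]
  congr 2
  push_cast; ring

/-- The coherent state `e_z` as an element of `L₂(ℝ)`. -/
def coherent (z : Phase) : L2 := (memLp_gaborFun z).toLp (gaborFun z)

/-- The Gabor transform `z ↦ ⟨f | e_z⟩ = ∫ f(x) conj (e_z(x)) dx`
(Mathlib's inner product is conjugate linear in its first argument). -/
def gaborTransform (f : L2) (z : Phase) : ℂ := inner ℂ (coherent z) f

/-- `f ∈ H^δ`: the integral `∫ (|z|^δ + 1) |⟨f | e_z⟩|² dz` is finite. -/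
def MemH (δ : ℝ) (f : L2) : Prop :=
  Integrable (fun z : Phase => (‖z‖ ^ δ + 1) * ‖gaborTransform f z‖ ^ 2) volume

/-- The norm `‖f‖_δ` of `f ∈ H^δ`. -/
def normH (δ : ℝ) (f : L2) : ℝ :=
  Real.sqrt (∫ z : Phase, (‖z‖ ^ δ + 1) * ‖gaborTransform f z‖ ^ 2)

/-- The lattice `Λ` of the points with integer coordinates. -/
def lattice : Set Phase := {z | ∃ k j : ℤ, z = k + j * Complex.I}

/-- The point `♯ = (1/2, 1/2)`. -/
def sharp : Phase := 1 / 2 + 1 / 2 * Complex.I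

/-- The set `Λ + ♯` of sharp points. -/
def sharpLattice : Set Phase := {z | ∃ w ∈ lattice, z = w + sharp}

/-- A bounded set holds finitely many lattice points, so the sums over them are finite sums. -/
theorem finite_lattice_inter {D : Set Phase} (hD : Bornology.IsBounded D) :
    (lattice ∩ D).Finite := by
  obtain ⟨R, hR⟩ := hD.exists_norm_le
  refine ((Set.finite_Icc (-⌈R⌉) ⌈R⌉).image2 (fun k j : ℤ => (k + j * Complex.I : ℂ))
    (Set.finite_Icc (-⌈R⌉) ⌈R⌉)).subset ?_
  rintro z ⟨⟨k, j, rfl⟩, hz⟩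
  have h1 := (Complex.abs_re_le_norm _).trans (hR _ hz)
  have h2 := (Complex.abs_im_le_norm _).trans (hR _ hz)
  simp only [Complex.add_re, Complex.add_im, Complex.intCast_re, Complex.intCast_im,
    Complex.mul_re, Complex.mul_im, Complex.I_re, Complex.I_im, mul_zero, mul_one, sub_zero,
    zero_add, add_zero] at h1 h2
  have aux : ∀ n : ℤ, |(n : ℝ)| ≤ R → n ∈ Set.Icc (-⌈R⌉) ⌈R⌉ := by
    intro n hn
    have h3 : ((|n| : ℤ) : ℝ) ≤ ⌈R⌉ := by
      push_cast; exact hn.trans (Int.le_ceil R)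
    exact abs_le.mp (by exact_mod_cast h3)
  exact ⟨k, aux k h1, j, aux j h2, rfl⟩

/-- A bounded set holds finitely many sharp points. -/
theorem finite_sharpLattice_inter {D : Set Phase} (hD : Bornology.IsBounded D) :
    (sharpLattice ∩ D).Finite := by
  have hb : Bornology.IsBounded ((fun z : Phase => z - sharp) '' D) := by
    obtain ⟨R, hR⟩ := hD.exists_norm_le
    refine isBounded_iff_forall_norm_le.mpr ⟨R + ‖sharp‖, ?_⟩
    rintro _ ⟨z, hz, rfl⟩
    exact (norm_sub_le _ _).trans (by gcongr; exact hR z hz)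
  refine ((finite_lattice_inter hb).image (fun z => z + sharp)).subset ?_
  rintro _ ⟨⟨w, hw, rfl⟩, hz⟩
  exact ⟨w, ⟨hw, w + sharp, hz, by simp⟩, rfl⟩

end Gabor

end

/-! Let `φ` be the difference of `f` and its orthogonal projection onto the span of the coherent
states allowed in the decomposition. Then `‖φ‖² = ⟨φ, f⟩`, and since the Gabor transform is an
isometry into `L₂(Φ)`, this is the integral of a product of two Gabor transforms. Outside `D`,
Cauchy-Schwarz gives the first term of the bound. Inside `D`, Cauchy-Schwarz with the weight `|z|^δ
+ 1` reduces everything to `MassBound`: the transform of `φ`, weighted by `(|z|^δ + 1)⁻¹`, has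
exponentially little mass in `D`.

Up to a unimodular factor and complex conjugation, the transform of `φ` is `e^{-π|z|²/2} G(z)` with
`G` entire (`gaborTransform_eq_bargmann`). Orthogonality says that `G` vanishes at the lattice
points of `D` and at the sharp points of `D \ K`.

In the collar `r/4 ≤ dist(z, K) < r` the zeros have density 2, twice what the growth `e^{π|z|²/2}`
tolerates. Dividing by an entire function with exactly these zeros, of size `e^{π|z|²}`, makes `G`
small, of Gaussian order, well inside a disc of zeros (`exists_fockMod_le_of_vanish`). Points near
the boundary of `D` are centres of no large disc of zeros, but each collar point lies on the
boundary circle of one of radius `r/8`. Hadamard's three circles theorem carries the smallness to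
that circle (`exists_fockMod_sq_le_of_vanish`).

Near `K` only the zeros of density 1 remain. There `G = σ h` with `σ` of size `e^{π|z|²/2}`, so `h`
bounds the weighted modulus of `G` and is small in the collar. Cutting off `h²` inside the collar
and applying the Cauchy-Pompeiu inequality (`enorm_mul_le_lintegral`) bounds `|h(z)|²` by a Cauchy
potential of collar values. Integration in `z` against the weight costs a constant independent of
`K`, because the Cauchy potential of `(|z|^δ + 1)⁻¹` is bounded for `δ > 1`. The loss is an area `π
r²`, which the gain `decay r`, Gaussian in `r`, absorbs. -/

noncomputable section

/-! ### Plancherel's theorem for the Fourier integral. -/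

namespace Gabor

open scoped FourierTransform ContDiff ComplexConjugate ENNReal

/-- On `L¹ ∩ L²` the `L²`-Fourier transform is given by the Fourier integral. -/
theorem fourier_toLp_ae_eq {h : ℝ → ℂ} (h1 : Integrable h) (h2 : MemLp h 2) :
    (𝓕 (h2.toLp h : L2) : L2) =ᵐ[volume] 𝓕 h := by
  have hcont : Continuous (𝓕 h) :=
    VectorFourier.fourierIntegral_continuous Real.continuous_fourierChar
      (by exact continuous_inner) h1
  refine ae_eq_of_integral_contDiff_smul_eq ((Lp.memLp _).locallyIntegrable one_le_two)
    hcont.locallyIntegrable fun g hg hgc => ?_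
  have hg' : ContDiff ℝ ∞ (fun x => (g x : ℂ)) := Complex.ofRealCLM.contDiff.comp hg
  have hgc' : HasCompactSupport (fun x => (g x : ℂ)) := hgc.comp_left Complex.ofReal_zero
  have e1 := congrArg (fun T => T (hgc'.toSchwartzMap hg'))
    (Lp.fourier_toTemperedDistribution_eq (h2.toLp h : L2))
  simp only [TemperedDistribution.fourier_apply, Lp.toTemperedDistribution_apply] at e1
  have e2 : ∫ x, g x • (𝓕 (h2.toLp h : L2) : L2) x
      = ∫ x, (hgc'.toSchwartzMap hg') x • (𝓕 (h2.toLp h : L2) : L2) x := by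
    refine integral_congr_ae (Filter.Eventually.of_forall fun x => ?_)
    simp [Complex.real_smul]
  rw [e2, ← e1]
  have e3 : ∫ x, (𝓕 (hgc'.toSchwartzMap hg')) x • (h2.toLp h : L2) x
      = ∫ x, (𝓕 (hgc'.toSchwartzMap hg')) x • h x := by
    refine integral_congr_ae ?_
    filter_upwards [h2.coeFn_toLp] with x hx
    rw [hx]
  rw [e3, SchwartzMap.fourier_coe]
  -- For integrable functions the Fourier integral moves from one factor to the other by Fubini;
  -- both transforms of `h` thus have the same pairing with every test function.
  have e4 := VectorFourier.integral_fourierIntegral_smul_eq_flip (μ := (volume : Measure ℝ))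
    (ν := (volume : Measure ℝ)) (L := innerₗ ℝ)
    Real.continuous_fourierChar (by exact continuous_inner)
    ((hgc'.toSchwartzMap hg').integrable (μ := volume)) h1
  have hflip : (innerₗ ℝ).flip = innerₗ ℝ := flip_innerₗ ℝ
  rw [hflip] at e4
  refine Eq.trans e4 (integral_congr_ae (Filter.Eventually.of_forall fun x => ?_))
  change (g x : ℂ) • 𝓕 h x = g x • 𝓕 h x
  rw [Complex.real_smul, smul_eq_mul]

theorem lintegral_enorm_sq (F : L2) : ∫⁻ x, ‖F x‖ₑ ^ 2 = ‖F‖ₑ ^ 2 := by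
  rw [Lp.enorm_def, eLpNorm_eq_lintegral_rpow_enorm_toReal two_ne_zero ENNReal.ofNat_ne_top,
    ← ENNReal.rpow_natCast, ← ENNReal.rpow_mul]
  simp

/-- Plancherel's theorem for the Fourier integral on `L¹ ∩ L²`. -/
theorem lintegral_enorm_fourier_sq {h : ℝ → ℂ} (h1 : Integrable h) (h2 : MemLp h 2) :
    ∫⁻ t, ‖𝓕 h t‖ₑ ^ 2 = ∫⁻ x, ‖h x‖ₑ ^ 2 := by
  have e1 : ∫⁻ t, ‖𝓕 h t‖ₑ ^ 2 = ∫⁻ t, ‖(𝓕 (h2.toLp h : L2) : L2) t‖ₑ ^ 2 :=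
    lintegral_congr_ae (by filter_upwards [fourier_toLp_ae_eq h1 h2] with t ht; rw [ht])
  have e2 : ∫⁻ x, ‖h x‖ₑ ^ 2 = ∫⁻ x, ‖(h2.toLp h : L2) x‖ₑ ^ 2 :=
    lintegral_congr_ae (by filter_upwards [h2.coeFn_toLp] with t ht; rw [ht])
  rw [e1, e2, lintegral_enorm_sq, lintegral_enorm_sq, enorm_eq_iff_norm_eq.mpr (Lp.norm_fourier_eq _)]

/-! ### The Bargmann transform: from coherent states to entire functions. -/

/-- The integrand of the Bargmann transform. -/
def bargmannKernel (z : ℂ) (x : ℝ) : ℂ :=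
  ((2 : ℝ) ^ (1 / 4 : ℝ) : ℝ) *
    Complex.exp (-Real.pi * x ^ 2 + 2 * Real.pi * x * z - Real.pi * z ^ 2 / 2)

/-- The Bargmann transform of the complex conjugate of `g`. -/
def bargmann (g : L2) (z : ℂ) : ℂ := ∫ x : ℝ, conj (g x) * bargmannKernel z x

/-- Gaussian domination, uniform for `‖z‖ ≤ R`, of the kernel and of its `z`-derivative: a square
integrable bound, hence integrable against any `g` in `L₂`. The linear factor of the derivative is
absorbed into an exponential. -/
theorem norm_bargmannKernel_le {z : ℂ} {R : ℝ} (hz : ‖z‖ ≤ R) (x : ℝ) :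
    ‖bargmannKernel z x‖ * ‖2 * Real.pi * x - Real.pi * z‖ ≤
        (2 : ℝ) ^ (1 / 4 : ℝ) * Real.exp (5 * Real.pi * R ^ 2 / 2 + 4 * Real.pi + Real.pi * R) *
          Real.exp (-(Real.pi / 4) * x ^ 2) ∧
      ‖bargmannKernel z x‖ ≤
        (2 : ℝ) ^ (1 / 4 : ℝ) * Real.exp (5 * Real.pi * R ^ 2 / 2 + 4 * Real.pi + Real.pi * R) *
          Real.exp (-(Real.pi / 4) * x ^ 2) := by
  have hR : 0 ≤ R := (norm_nonneg z).trans hz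
  have hpi := Real.pi_pos
  have hre : x * z.re ≤ |x| * R := by
    have := abs_mul x z.re ▸ le_abs_self (x * z.re)
    exact this.trans (by gcongr; exact (Complex.abs_re_le_norm z).trans hz)
  have hsq : -(z ^ 2).re ≤ R ^ 2 := by
    have h := (abs_le.mp (Complex.abs_re_le_norm (z ^ 2))).1
    rw [norm_pow] at h
    nlinarith [norm_nonneg z, pow_le_pow_left₀ (norm_nonneg z) hz 2]
  have hn : ‖bargmannKernel z x‖ = (2 : ℝ) ^ (1 / 4 : ℝ) *
      Real.exp (-Real.pi * x ^ 2 + 2 * Real.pi * (x * z.re) - Real.pi * (z ^ 2).re / 2) := by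
    rw [bargmannKernel, norm_mul, Complex.norm_exp, Complex.norm_real,
      Real.norm_of_nonneg (by positivity)]
    congr 2
    have : (-Real.pi * x ^ 2 + 2 * Real.pi * x * z - Real.pi * z ^ 2 / 2 : ℂ)
      = ((-Real.pi * x ^ 2 : ℝ) : ℂ) + ((2 * Real.pi * x : ℝ) : ℂ) * z
        - ((Real.pi / 2 : ℝ) : ℂ) * z ^ 2 := by push_cast; ring
    rw [this, Complex.sub_re, Complex.add_re, Complex.ofReal_re, Complex.re_ofReal_mul,
      Complex.re_ofReal_mul]
    ring
  have hx2 : |x| ^ 2 = x ^ 2 := sq_abs x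
  have hlin : ‖2 * Real.pi * x - Real.pi * z‖ ≤ Real.exp (2 * Real.pi * |x| + Real.pi * R) := by
    refine (norm_sub_le _ _).trans ?_
    have h1 : ‖(2 * Real.pi * x : ℂ)‖ = 2 * Real.pi * |x| := by
      simp [abs_of_pos hpi]
    have h2 : ‖(Real.pi * z : ℂ)‖ ≤ Real.pi * R := by
      rw [norm_mul, Complex.norm_real, Real.norm_of_nonneg hpi.le]; gcongr
    rw [h1]
    linarith [Real.add_one_le_exp (2 * Real.pi * |x| + Real.pi * R)]
  have hexp : -Real.pi * x ^ 2 + 2 * Real.pi * (x * z.re) - Real.pi * (z ^ 2).re / 2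
      + (2 * Real.pi * |x| + Real.pi * R) ≤
      (5 * Real.pi * R ^ 2 / 2 + 4 * Real.pi + Real.pi * R) + -(Real.pi / 4) * x ^ 2 := by
    -- Three quarters of `x²` are spent on completing the squares `(|x| - 2R)²/2` and `(|x| -
    -- 4)²/4`, which produce `2R²` and `4`.
    have h : -x ^ 2 + 2 * (x * z.re) - (z ^ 2).re / 2 + (2 * |x| + R)
        ≤ 5 * R ^ 2 / 2 + 4 + R - x ^ 2 / 4 := by
      rw [← hx2]
      nlinarith [sq_nonneg (|x| - 2 * R), sq_nonneg (|x| - 4)]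
    nlinarith
  constructor
  · rw [hn, mul_assoc ((2 : ℝ) ^ (1 / 4 : ℝ)), mul_assoc ((2 : ℝ) ^ (1 / 4 : ℝ)), ← Real.exp_add]
    gcongr
    calc _ ≤ Real.exp (-Real.pi * x ^ 2 + 2 * Real.pi * (x * z.re) - Real.pi * (z ^ 2).re / 2) *
          Real.exp (2 * Real.pi * |x| + Real.pi * R) := by gcongr
      _ ≤ _ := by rw [← Real.exp_add]; gcongr
  · rw [hn, mul_assoc ((2 : ℝ) ^ (1 / 4 : ℝ)), ← Real.exp_add]
    gcongr
    have : 0 ≤ 2 * Real.pi * |x| + Real.pi * R := by positivity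
    linarith

theorem memLp_gaussian {b : ℝ} (hb : 0 < b) (c : ℝ) :
    MemLp (fun x : ℝ => c * Real.exp (-b * x ^ 2)) 2 := by
  refine MemLp.const_mul ?_ c
  rw [memLp_two_iff_integrable_sq_norm (by fun_prop)]
  refine (integrable_exp_neg_mul_sq (b := 2 * b) (by positivity)).congr
    (Filter.Eventually.of_forall fun x => ?_)
  simp only [Real.norm_eq_abs, Real.abs_exp, ← Real.exp_nat_mul]
  congr 1
  push_cast; ring

theorem differentiable_bargmann (g : L2) : Differentiable ℂ (bargmann g) := by
  intro z₀
  have hgm : AEStronglyMeasurable (fun x => conj (g x)) volume :=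
    Complex.continuous_conj.comp_aestronglyMeasurable (Lp.memLp g).1
  have hk : ∀ z, Continuous (bargmannKernel z) := fun z => by unfold bargmannKernel; fun_prop
  set R := ‖z₀‖ + 1
  set c := (2 : ℝ) ^ (1 / 4 : ℝ) * Real.exp (5 * Real.pi * R ^ 2 / 2 + 4 * Real.pi + Real.pi * R)
  have hint : Integrable (fun x => ‖g x‖ * (c * Real.exp (-(Real.pi / 4) * x ^ 2))) :=
    (Lp.memLp g).norm.integrable_mul (memLp_gaussian (by positivity) c)
  have h := hasDerivAt_integral_of_dominated_loc_of_deriv_le (𝕜 := ℂ) (μ := volume)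
    (F := fun z x => conj (g x) * bargmannKernel z x)
    (F' := fun z x => conj (g x) * (bargmannKernel z x * (2 * Real.pi * x - Real.pi * z)))
    (x₀ := z₀) (s := Metric.ball z₀ 1)
    (bound := fun x => ‖g x‖ * (c * Real.exp (-(Real.pi / 4) * x ^ 2)))
    (Metric.ball_mem_nhds _ one_pos)
    (Filter.Eventually.of_forall fun z => hgm.mul (hk z).aestronglyMeasurable)
    ?_ (hgm.mul ((hk z₀).mul (by fun_prop)).aestronglyMeasurable) ?_ hint ?_
  · exact h.2.differentiableAt
  · refine hint.mono' (hgm.mul (hk z₀).aestronglyMeasurable)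
      (Filter.Eventually.of_forall fun x => ?_)
    rw [norm_mul, RCLike.norm_conj]
    gcongr
    exact (norm_bargmannKernel_le (by simp [R]) x).2
  · refine Filter.Eventually.of_forall fun x z hz => ?_
    rw [norm_mul, RCLike.norm_conj, norm_mul]
    refine mul_le_mul_of_nonneg_left ?_ (norm_nonneg _)
    refine (norm_bargmannKernel_le ?_ x).1
    have := norm_sub_norm_le z z₀
    rw [mem_ball_iff_norm] at hz
    simp only [R]; linarith
  · refine Filter.Eventually.of_forall fun x z _ => HasDerivAt.const_mul _ ?_
    unfold bargmannKernel
    rw [mul_assoc (((2 : ℝ) ^ (1 / 4 : ℝ) : ℝ) : ℂ)]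
    refine HasDerivAt.const_mul _ (HasDerivAt.cexp ?_)
    have h1 : HasDerivAt (fun z : ℂ => 2 * Real.pi * x * z) (2 * Real.pi * x) z := by
      simpa using (hasDerivAt_id z).const_mul (2 * Real.pi * x : ℂ)
    have h2 : HasDerivAt (fun z : ℂ => Real.pi * z ^ 2 / 2) (Real.pi * z) z := by
      convert! ((hasDerivAt_pow 2 z).const_mul (Real.pi : ℂ)).div_const 2 using 1
      push_cast; ring
    convert! ((h1.const_add (-Real.pi * (x : ℂ) ^ 2)).sub h2) using 1

/-- Expanding the square in the Gaussian separates a factor depending on `z` alone, of modulus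
`e^{-π|z|²/2}`, from an integral holomorphic in `z`. The transform therefore has the zeros of an
entire function. -/
theorem gaborTransform_eq_bargmann (g : L2) (z : ℂ) :
    gaborTransform g z = conj (bargmann g z) *
      Complex.exp (-(Real.pi * ‖z‖ ^ 2 / 2 : ℝ) - (Real.pi * z.re * z.im : ℝ) * Complex.I) := by
  rw [gaborTransform, L2.inner_def, bargmann, ← integral_conj, ← integral_mul_const]
  refine integral_congr_ae ?_
  filter_upwards [(memLp_gaborFun z).coeFn_toLp] with x hx
  rw [coherent, hx]
  simp only [RCLike.inner_apply, map_mul, Complex.conj_conj, bargmannKernel, gaborFun,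
    ← Complex.exp_conj, Complex.conj_ofReal]
  rw [mul_assoc (g x), mul_assoc (((2 : ℝ) ^ (1 / 4 : ℝ) : ℝ) : ℂ), ← Complex.exp_add]
  congr 3
  have hz : (‖z‖ ^ 2 : ℝ) = z.re ^ 2 + z.im ^ 2 := by
    rw [Complex.sq_norm, Complex.normSq_apply]; ring
  rw [hz]
  simp only [map_sub, map_add, map_mul, map_neg, map_pow, map_div₀, Complex.conj_ofReal, map_ofNat,
    Complex.conj_I]
  apply Complex.ext <;> simp [pow_two] <;> ring

theorem norm_gaborTransform (g : L2) (z : ℂ) :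
    ‖bargmann g z‖ = ‖gaborTransform g z‖ * Real.exp (Real.pi * ‖z‖ ^ 2 / 2) := by
  rw [gaborTransform_eq_bargmann, norm_mul, RCLike.norm_conj, Complex.norm_exp, mul_assoc,
    ← Real.exp_add, Complex.sub_re, Complex.re_ofReal_mul, Complex.I_re, Complex.neg_re,
    Complex.ofReal_re]
  simp

theorem continuous_gaborTransform (g : L2) : Continuous (gaborTransform g) := by
  have h : gaborTransform g = _ := funext fun z => gaborTransform_eq_bargmann g z
  rw [h]
  have := (differentiable_bargmann g).continuous
  fun_prop

/-! ### The Gabor transform as an isometry. -/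

theorem gaborTransform_eq_fourier (f : L2) (z : ℂ) :
    gaborTransform f z = 𝓕 (fun x : ℝ => f x *
      (((2 : ℝ) ^ (1 / 4 : ℝ) * Real.exp (-Real.pi * (x - z.re) ^ 2) : ℝ) : ℂ)) z.im := by
  rw [gaborTransform, L2.inner_def, Real.fourier_real_eq_integral_exp_smul]
  refine integral_congr_ae ?_
  filter_upwards [(memLp_gaborFun z).coeFn_toLp] with x hx
  rw [coherent, hx]
  simp only [RCLike.inner_apply, gaborFun, map_mul, ← Complex.exp_conj, Complex.conj_ofReal]
  rw [smul_eq_mul, mul_left_comm _ (f x), Complex.ofReal_mul (2 ^ (1 / 4 : ℝ)), Complex.ofReal_exp]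
  rw [mul_left_comm (Complex.exp _) (((2 : ℝ) ^ (1 / 4 : ℝ) : ℝ) : ℂ), ← Complex.exp_add]
  congr 3
  apply Complex.ext <;> simp [pow_two]
  ring

/-- For fixed position the transform is the Fourier integral of `f` times a Gaussian window, so
Plancherel applies in the frequency variable. Tonelli then integrates over positions, and the
squared window `√2 e^{-2πx²}` has integral 1. -/
theorem lintegral_enorm_gaborTransform_sq (f : L2) :
    ∫⁻ z, ‖gaborTransform f z‖ₑ ^ 2 = ‖f‖ₑ ^ 2 := by
  have hm : Measurable fun z => ‖gaborTransform f z‖ₑ ^ 2 :=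
    (continuous_gaborTransform f).measurable.enorm.pow_const 2
  rw [← Complex.volume_preserving_equiv_real_prod.symm.lintegral_comp hm,
    Measure.volume_eq_prod, lintegral_prod (fun a : ℝ × ℝ =>
      ‖gaborTransform f (Complex.measurableEquivRealProd.symm a)‖ₑ ^ 2)
      (hm.comp (MeasurableEquiv.measurable _)).aemeasurable]
  have hw : ∀ p : ℝ, MemLp (fun x : ℝ =>
      (((2 : ℝ) ^ (1 / 4 : ℝ) * Real.exp (-Real.pi * (x - p) ^ 2) : ℝ) : ℂ)) 2 := fun p =>
    ((memLp_gaussian Real.pi_pos _).ofReal).comp_measurePreserving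
      (measurePreserving_sub_right volume p)
  have h1 : ∀ p : ℝ, ∫⁻ t : ℝ,
      ‖gaborTransform f (Complex.measurableEquivRealProd.symm (p, t))‖ₑ ^ 2 =
      ∫⁻ x, ‖f x‖ₑ ^ 2 * ENNReal.ofReal (Real.sqrt 2 * Real.exp (-(2 * Real.pi) * (x - p) ^ 2)) := by
    intro p
    have hb : MemLp (fun x : ℝ => f x *
      (((2 : ℝ) ^ (1 / 4 : ℝ) * Real.exp (-Real.pi * (x - p) ^ 2) : ℝ) : ℂ)) 2 := by
      refine MemLp.of_le_mul (c := (2 : ℝ) ^ (1 / 4 : ℝ)) (Lp.memLp f)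
        ((Lp.memLp f).1.mul (hw p).1) (Filter.Eventually.of_forall fun x => ?_)
      rw [norm_mul, Complex.norm_real, Real.norm_of_nonneg (by positivity), mul_comm]
      gcongr
      refine mul_le_of_le_one_right (by positivity) (Real.exp_le_one_iff.mpr ?_)
      nlinarith [Real.pi_pos, sq_nonneg (x - p), mul_nonneg Real.pi_pos.le (sq_nonneg (x - p))]
    have := lintegral_enorm_fourier_sq ((Lp.memLp f).integrable_mul (hw p)) hb
    have e : ∀ t : ℝ, gaborTransform f (Complex.measurableEquivRealProd.symm (p, t)) =
        𝓕 (fun x : ℝ => f x *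
      (((2 : ℝ) ^ (1 / 4 : ℝ) * Real.exp (-Real.pi * (x - p) ^ 2) : ℝ) : ℂ)) t := fun t => by
      rw [gaborTransform_eq_fourier]
      simp [Complex.measurableEquivRealProd]
    simp_rw [e]
    refine this.trans (lintegral_congr fun x => ?_)
    simp only [Pi.mul_apply]
    rw [enorm_mul, mul_pow, ← ofReal_norm (Complex.ofReal _), Complex.norm_real,
      Real.norm_of_nonneg (by positivity), ← ENNReal.ofReal_pow (by positivity), mul_pow,
      ← Real.rpow_natCast, ← Real.rpow_mul (by positivity), ← Real.exp_nat_mul, Real.sqrt_eq_rpow]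
    congr 4
    · norm_num
    · push_cast; ring
  simp_rw [h1]
  rw [lintegral_lintegral_swap]
  · have h2 : ∀ x : ℝ, ∫⁻ p : ℝ, ENNReal.ofReal
        (Real.sqrt 2 * Real.exp (-(2 * Real.pi) * (x - p) ^ 2)) = 1 := by
      intro x
      rw [← ofReal_integral_eq_lintegral_ofReal
        (((integrable_exp_neg_mul_sq (b := 2 * Real.pi) (by positivity)).comp_sub_left
        x).const_mul _) (Filter.Eventually.of_forall fun p => by positivity), integral_const_mul,
        integral_sub_left_eq_self (fun p : ℝ => Real.exp (-(2 * Real.pi) * p ^ 2)) volume x,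
        integral_gaussian, ← Real.sqrt_mul (by norm_num)]
      have : 2 * (Real.pi / (2 * Real.pi)) = 1 := by field_simp
      rw [this]; simp
    have h3 : ∀ x : ℝ, ∫⁻ p : ℝ, ‖f x‖ₑ ^ 2 * ENNReal.ofReal
        (Real.sqrt 2 * Real.exp (-(2 * Real.pi) * (x - p) ^ 2)) = ‖f x‖ₑ ^ 2 := fun x => by
      rw [lintegral_const_mul _ (by fun_prop), h2, mul_one]
    simp_rw [h3]
    exact lintegral_enorm_sq f
  · refine AEMeasurable.mul (f := fun q : ℝ × ℝ => ‖f q.2‖ₑ ^ 2) (g := fun q : ℝ × ℝ =>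
      ENNReal.ofReal (Real.sqrt 2 * Real.exp (-(2 * Real.pi) * (q.2 - q.1) ^ 2)))
      ?_ (by fun_prop)
    exact ((Lp.memLp f).1.comp_snd).enorm.pow_const 2

theorem memLp_gaborTransform (f : L2) : MemLp (gaborTransform f) 2 volume := by
  refine ⟨(continuous_gaborTransform f).aestronglyMeasurable, ?_⟩
  have h := lintegral_enorm_gaborTransform_sq f
  rw [eLpNorm_lt_top_iff_lintegral_rpow_enorm_lt_top two_ne_zero ENNReal.ofNat_ne_top]
  simp only [ENNReal.toReal_ofNat, ENNReal.rpow_ofNat]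
  rw [h]
  exact ENNReal.pow_lt_top enorm_lt_top

/-- The Gabor transform as an isometry of `L₂(ℝ)` into `L₂(Φ)`. -/
def gaborIsometry : L2 →ₗᵢ[ℂ] Lp ℂ 2 (volume : Measure Phase) where
  toFun f := (memLp_gaborTransform f).toLp _
  map_add' f g := by
    rw [← MemLp.toLp_add]
    congr 1; ext z; simp [gaborTransform, inner_add_right]
  map_smul' c f := by
    rw [RingHom.id_apply, ← MemLp.toLp_const_smul]
    congr 1; ext z; simp [gaborTransform, inner_smul_right]
  norm_map' f := by
    rw [← enorm_eq_iff_norm_eq]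
    have h := lintegral_enorm_gaborTransform_sq f
    simp only [LinearMap.coe_mk, AddHom.coe_mk, Lp.enorm_toLp]
    rw [eLpNorm_eq_lintegral_rpow_enorm_toReal two_ne_zero ENNReal.ofNat_ne_top]
    simp only [ENNReal.toReal_ofNat, ENNReal.rpow_ofNat, h]
    rw [← ENNReal.rpow_natCast, ← ENNReal.rpow_mul]
    simp

theorem inner_eq_integral_gaborTransform (f g : L2) :
    inner ℂ g f = ∫ z : Phase, gaborTransform f z * conj (gaborTransform g z) := by
  rw [← gaborIsometry.inner_map_map, L2.inner_def]
  refine integral_congr_ae ?_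
  filter_upwards [(memLp_gaborTransform f).coeFn_toLp, (memLp_gaborTransform g).coeFn_toLp]
    with z h1 h2
  simp only [gaborIsometry, LinearIsometry.coe_mk, LinearMap.coe_mk, AddHom.coe_mk, h1, h2,
    RCLike.inner_apply]

end Gabor

end

/-! ### Entire functions with the lattice as zero set, and their size. -/

noncomputable section

namespace Gabor

/-- The entire function `W ↦ ∏ (1 - e^{-2πn} W)` with the zeros `e^{2πn}`, `n ≥ 0`. -/
def eulerProd (W : ℂ) : ℂ := ∏' n : ℕ, (1 + -(Real.exp (-2 * Real.pi) : ℂ) ^ n * W)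

theorem norm_exp_neg_two_pi : ‖(Real.exp (-2 * Real.pi) : ℂ)‖ = Real.exp (-2 * Real.pi) := by
  rw [Complex.norm_real, Real.norm_of_nonneg (Real.exp_pos _).le]

theorem exp_neg_two_pi_lt_one : Real.exp (-2 * Real.pi) < 1 := by
  rw [Real.exp_lt_one_iff]; linarith [Real.pi_pos]

theorem summable_eulerProd (W : ℂ) :
    Summable fun n : ℕ => ‖-(Real.exp (-2 * Real.pi) : ℂ) ^ n * W‖ := by
  simp only [norm_mul, norm_neg, norm_pow, norm_exp_neg_two_pi]
  exact (summable_geometric_of_lt_one (Real.exp_pos _).le exp_neg_two_pi_lt_one).mul_right _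

theorem differentiable_eulerProd : Differentiable ℂ eulerProd := by
  intro W
  have hu : Summable fun n : ℕ => Real.exp (-2 * Real.pi) ^ n * (‖W‖ + 1) :=
    (summable_geometric_of_lt_one (Real.exp_pos _).le exp_neg_two_pi_lt_one).mul_right _
  have h := hu.hasProdLocallyUniformlyOn_nat_one_add
    (f := fun n V => -(Real.exp (-2 * Real.pi) : ℂ) ^ n * V) (K := Metric.ball W 1)
    Metric.isOpen_ball
    (Filter.Eventually.of_forall fun n V hV => by
      rw [norm_mul, norm_neg, norm_pow, norm_exp_neg_two_pi]
      gcongr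
      have := norm_sub_norm_le V W
      rw [mem_ball_iff_norm] at hV
      linarith) (fun n => by fun_prop)
  refine (h.differentiableOn (Filter.Eventually.of_forall fun s => ?_)
    Metric.isOpen_ball).differentiableAt (Metric.ball_mem_nhds _ one_pos)
  simpa [Finset.prod_fn] using
      DifferentiableOn.finsetProd (fun _ _ ↦ by fun_prop)

/-- Splitting off the factor `n = 0` shifts the index. This functional equation yields the
quasi-periodicity of `sigma` in the direction `i`. -/
theorem eulerProd_eq (W : ℂ) :
    eulerProd W = (1 - W) * eulerProd (Real.exp (-2 * Real.pi) * W) := by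
  have hs := summable_eulerProd W
  rw [eulerProd, eulerProd]
  generalize (Real.exp (-2 * Real.pi) : ℂ) = q at hs
  have hs' : Summable fun n : ℕ => ‖-q ^ (n + 1) * W‖ := (summable_nat_add_iff 1).mpr hs
  have h := tprod_eq_zero_mul' (f := fun n : ℕ => 1 + -q ^ n * W)
    (multipliable_one_add_of_summable hs')
  rw [h]
  congr 1
  · rw [pow_zero, neg_one_mul, sub_eq_add_neg]
  · refine tprod_congr fun n => ?_
    ring

theorem eulerProd_ne_zero {W : ℂ} (hW : ‖W‖ < 1) : eulerProd W ≠ 0 := by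
  refine tprod_one_add_ne_zero_of_summable (fun n h => ?_) (summable_eulerProd W)
  have h1 : ‖(Real.exp (-2 * Real.pi) : ℂ) ^ n * W‖ < 1 := by
    rw [norm_mul, norm_pow, norm_exp_neg_two_pi]
    calc _ ≤ 1 * ‖W‖ := by
          gcongr
          exact pow_le_one₀ (Real.exp_pos _).le exp_neg_two_pi_lt_one.le
      _ < 1 := by simpa using hW
  have h2 : (Real.exp (-2 * Real.pi) : ℂ) ^ n * W = 1 := by linear_combination -h
  rw [h2] at h1
  simp at h1

/-- An entire function of the type of Weierstrass' sigma function of the Gaussian integers. -/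
def sigma (z : ℂ) : ℂ :=
  Complex.exp (Real.pi * z ^ 2 / 2 - Complex.I * Real.pi * z) *
    (eulerProd (Complex.exp (2 * Real.pi * Complex.I * z)) *
      eulerProd (Real.exp (-2 * Real.pi) * Complex.exp (-(2 * Real.pi * Complex.I * z))))

theorem differentiable_sigma : Differentiable ℂ sigma := by
  unfold sigma
  refine Differentiable.mul (by fun_prop) (Differentiable.mul ?_ ?_)
  · exact differentiable_eulerProd.comp (by fun_prop)
  · exact differentiable_eulerProd.comp (by fun_prop)

theorem sigma_add_one (z : ℂ) :
    sigma (z + 1) = -Complex.exp (Real.pi * z + Real.pi / 2) * sigma z := by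
  have h1 : Complex.exp (2 * Real.pi * Complex.I * (z + 1))
      = Complex.exp (2 * Real.pi * Complex.I * z) := by
    rw [mul_add, mul_one, Complex.exp_add, Complex.exp_two_pi_mul_I, mul_one]
  have h2 : Complex.exp (Real.pi * (z + 1) ^ 2 / 2 - Complex.I * Real.pi * (z + 1))
      = -Complex.exp (Real.pi * z + Real.pi / 2) *
        Complex.exp (Real.pi * z ^ 2 / 2 - Complex.I * Real.pi * z) := by
    have : Complex.exp (-(Real.pi * Complex.I)) = -1 := by
      rw [Complex.exp_neg, Complex.exp_pi_mul_I]; norm_num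
    rw [neg_mul, ← Complex.exp_add, neg_eq_neg_one_mul, ← this, ← Complex.exp_add]
    congr 1; ring
  rw [sigma, sigma, Complex.exp_neg (2 * Real.pi * Complex.I * (z + 1)), h1, h2, Complex.exp_neg]
  ring

theorem sigma_add_I (z : ℂ) :
    sigma (z + Complex.I) = -Complex.exp (-(Complex.I * Real.pi * z) + Real.pi / 2) * sigma z := by
  set W := Complex.exp (2 * Real.pi * Complex.I * z) with hW
  set q : ℂ := (Real.exp (-2 * Real.pi) : ℂ) with hq
  have hq' : q = Complex.exp (-2 * Real.pi) := by rw [hq]; push_cast; rfl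
  have hI := Complex.I_mul_I
  have hq0 : q ≠ 0 := by rw [hq']; exact Complex.exp_ne_zero _
  have h1 : Complex.exp (2 * Real.pi * Complex.I * (z + Complex.I)) = q * W := by
    rw [hq', hW, ← Complex.exp_add]; congr 1
    linear_combination 2 * Real.pi * hI
  have hW0 : W ≠ 0 := Complex.exp_ne_zero _
  have h2 : q * Complex.exp (-(2 * Real.pi * Complex.I * (z + Complex.I))) = W⁻¹ := by
    rw [Complex.exp_neg, h1]; field_simp
  have h3 : Complex.exp (Real.pi * (z + Complex.I) ^ 2 / 2 - Complex.I * Real.pi * (z + Complex.I))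
      = W * Complex.exp (-(Complex.I * Real.pi * z) + Real.pi / 2) *
        Complex.exp (Real.pi * z ^ 2 / 2 - Complex.I * Real.pi * z) := by
    rw [hW, ← Complex.exp_add, ← Complex.exp_add]; congr 1
    linear_combination (-Real.pi / 2) * hI
  -- The shift by `i` drops the factor `1 - W` from one product and adds `1 - W⁻¹` to the other;
  -- their quotient `-W⁻¹` cancels the `W` from the Gaussian factor up to sign.
  rw [sigma, sigma, h1, h2, h3, ← hW, Complex.exp_neg, ← hW, eulerProd_eq W, eulerProd_eq W⁻¹, ← hq]
  field_simp
  ring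

theorem add_one_sq_norm (z : ℂ) : ‖z + 1‖ ^ 2 = ‖z‖ ^ 2 + 2 * z.re + 1 := by
  simp only [Complex.sq_norm, Complex.normSq_apply, Complex.add_re, Complex.add_im,
    Complex.one_re, Complex.one_im]
  ring

theorem add_I_sq_norm (z : ℂ) : ‖z + Complex.I‖ ^ 2 = ‖z‖ ^ 2 + 2 * z.im + 1 := by
  simp only [Complex.sq_norm, Complex.normSq_apply, Complex.add_re, Complex.add_im,
    Complex.I_re, Complex.I_im]
  ring

/-- The modulus of `sigma` relative to `e^{π|z|²/2}`, a doubly periodic function. -/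
def sigmaMod (z : ℂ) : ℝ := ‖sigma z‖ * Real.exp (-(Real.pi * ‖z‖ ^ 2 / 2))

theorem sigmaMod_add_one (z : ℂ) : sigmaMod (z + 1) = sigmaMod z := by
  rw [sigmaMod, sigmaMod, sigma_add_one, norm_mul, norm_neg, Complex.norm_exp, add_one_sq_norm,
    mul_comm (Real.exp _), mul_assoc, ← Real.exp_add]
  congr 2
  have : (Real.pi * z + Real.pi / 2 : ℂ).re = Real.pi * z.re + Real.pi / 2 := by simp
  rw [this]; ring

theorem sigmaMod_add_I (z : ℂ) : sigmaMod (z + Complex.I) = sigmaMod z := by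
  rw [sigmaMod, sigmaMod, sigma_add_I, norm_mul, norm_neg, Complex.norm_exp, add_I_sq_norm,
    mul_comm (Real.exp _), mul_assoc, ← Real.exp_add]
  congr 2
  have : (-(Complex.I * Real.pi * z) + Real.pi / 2 : ℂ).re = Real.pi * z.im + Real.pi / 2 := by
    simp
  rw [this]; ring

theorem iff_add_int {P : ℂ → Prop} {a : ℂ} (h : ∀ z, P (z + a) ↔ P z) (z : ℂ) (k : ℤ) :
    P (z + k * a) ↔ P z := by
  induction k using Int.induction_on with
  | zero => simp
  | succ n ih => rw [← ih, ← h (z + (n : ℤ) * a)]; push_cast; ring_nf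
  | pred n ih => rw [← ih, ← h (z + ((-(n : ℤ) - 1 : ℤ) : ℂ) * a)]; push_cast; ring_nf

theorem sigmaMod_add_lattice (z : ℂ) (k j : ℤ) :
    sigmaMod (z + (k + j * Complex.I)) = sigmaMod z := by
  have h1 := (iff_add_int (P := fun w => sigmaMod w = sigmaMod z) (a := 1)
    (fun w => by rw [sigmaMod_add_one]) z k).mpr rfl
  have h2 := (iff_add_int (P := fun w => sigmaMod w = sigmaMod z) (a := Complex.I)
    (fun w => by rw [sigmaMod_add_I]) (z + k * 1) j).mpr h1
  rw [← h2]; ring_nf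

theorem continuous_sigmaMod : Continuous sigmaMod := by
  have := differentiable_sigma.continuous
  unfold sigmaMod; fun_prop

/-- With `W = e^{2πiz}`, in this strip `e^{-2π} W` and `e^{-2π} W⁻¹` have modulus at most `e^{-π}`,
so of all the factors only `1 - W` can vanish. -/
theorem sigma_eq_zero_iff_of_mem_strip {z : ℂ} (hz : |z.im| ≤ 1 / 2) :
    sigma z = 0 ↔ Complex.exp (2 * Real.pi * Complex.I * z) = 1 := by
  set W := Complex.exp (2 * Real.pi * Complex.I * z) with hW
  obtain ⟨hz1, hz2⟩ := abs_le.mp hz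
  have hpi := Real.pi_pos
  have hn : ‖W‖ = Real.exp (-(2 * Real.pi * z.im)) := by
    rw [hW, Complex.norm_exp]; congr 1; simp
  have h1 : eulerProd (Real.exp (-2 * Real.pi) * W) ≠ 0 := eulerProd_ne_zero (by
    rw [norm_mul, norm_exp_neg_two_pi, hn, ← Real.exp_add, Real.exp_lt_one_iff]
    nlinarith)
  have h2 : eulerProd (Real.exp (-2 * Real.pi) * Complex.exp (-(2 * Real.pi * Complex.I * z))) ≠ 0 :=
    eulerProd_ne_zero (by
      rw [norm_mul, norm_exp_neg_two_pi, Complex.exp_neg, norm_inv, ← hW, hn, ← Real.exp_neg,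
        ← Real.exp_add, Real.exp_lt_one_iff]
      nlinarith)
  rw [sigma, ← hW, eulerProd_eq W]
  simp only [mul_eq_zero, Complex.exp_ne_zero, h1, h2, false_or, or_false]
  rw [sub_eq_zero, eq_comm]

theorem exists_lattice_translate (z : ℂ) :
    ∃ (w : ℂ) (k j : ℤ), z = w + (k + j * Complex.I) ∧ |w.re| ≤ 1 / 2 ∧ |w.im| ≤ 1 / 2 := by
  refine ⟨z - (round z.re + round z.im * Complex.I), round z.re, round z.im, by ring, ?_, ?_⟩
  · simpa using abs_sub_round z.re
  · simpa using abs_sub_round z.im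

theorem sigmaMod_eq_zero_iff (z : ℂ) : sigmaMod z = 0 ↔ sigma z = 0 := by
  simp [sigmaMod, (Real.exp_pos _).ne']

theorem eq_zero_of_sigma_eq_zero {w : ℂ} (h1 : |w.re| ≤ 1 / 2) (h2 : |w.im| ≤ 1 / 2)
    (h : sigma w = 0) : w = 0 := by
  rw [sigma_eq_zero_iff_of_mem_strip h2, Complex.exp_eq_one_iff] at h
  obtain ⟨n, hn⟩ := h
  have h3 : w = n := by
    have : (2 * Real.pi * Complex.I : ℂ) ≠ 0 := Complex.two_pi_I_ne_zero
    refine mul_left_cancel₀ this ?_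
    rw [hn]; ring
  rw [h3, Complex.intCast_re] at h1
  have h4 : |n| < 1 := by
    have : |(n : ℝ)| < 1 := by linarith
    exact_mod_cast this
  rw [h3, Int.abs_lt_one_iff.mp h4, Int.cast_zero]

theorem sigma_zero : sigma 0 = 0 := by
  rw [sigma_eq_zero_iff_of_mem_strip (by simp)]; simp

theorem sigma_eq_zero_iff (z : ℂ) : sigma z = 0 ↔ z ∈ lattice := by
  obtain ⟨w, k, j, rfl, h1, h2⟩ := exists_lattice_translate z
  rw [← sigmaMod_eq_zero_iff, sigmaMod_add_lattice, sigmaMod_eq_zero_iff]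
  constructor
  · intro h
    rw [eq_zero_of_sigma_eq_zero h1 h2 h]
    exact ⟨k, j, by simp⟩
  · rintro ⟨k', j', h⟩
    have h3 : w = 0 + (((k' - k : ℤ) : ℂ) + ((j' - j : ℤ) : ℂ) * Complex.I) := by
      push_cast; linear_combination h
    rw [h3, ← sigmaMod_eq_zero_iff, sigmaMod_add_lattice, sigmaMod_eq_zero_iff, sigma_zero]

/-- At a zero of `f` the product rule leaves only `A f'`, so simplicity of zeros is invariant under
the translation and need only be checked at the origin. -/
theorem deriv_ne_zero_of_quasiperiodic {f A : ℂ → ℂ} {a : ℂ} (hf : Differentiable ℂ f)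
    (hA : Differentiable ℂ A) (hA0 : ∀ z, A z ≠ 0) (h : ∀ z, f (z + a) = A z * f z) (z : ℂ) :
    (f (z + a) = 0 ∧ deriv f (z + a) ≠ 0) ↔ (f z = 0 ∧ deriv f z ≠ 0) := by
  rw [h z, mul_eq_zero, or_iff_right (hA0 z)]
  refine and_congr_right fun h0 => not_congr ?_
  have h1 : deriv f (z + a) = deriv (fun w => A w * f w) z := by
    rw [← deriv_comp_add_const]
    exact congrArg (fun g => deriv g z) (funext h)
  rw [h1, deriv_fun_mul (hA z) (hf z), h0, mul_zero, zero_add, mul_eq_zero, or_iff_right (hA0 z)]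

theorem deriv_sigma_zero_ne : deriv sigma 0 ≠ 0 := by
  have hW : HasDerivAt (fun z : ℂ => 1 - Complex.exp (2 * Real.pi * Complex.I * z))
      (-(2 * Real.pi * Complex.I)) 0 := by
    have h := ((((hasDerivAt_id (0 : ℂ)).const_mul (2 * Real.pi * Complex.I)).cexp).const_sub 1)
    simpa using h
  set g : ℂ → ℂ := fun z => Complex.exp (Real.pi * z ^ 2 / 2 - Complex.I * Real.pi * z) *
    (eulerProd (Real.exp (-2 * Real.pi) * Complex.exp (2 * Real.pi * Complex.I * z)) *
      eulerProd (Real.exp (-2 * Real.pi) * Complex.exp (-(2 * Real.pi * Complex.I * z)))) with hg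
  have hgd : Differentiable ℂ g := by
    refine Differentiable.mul (by fun_prop) (Differentiable.mul ?_ ?_)
    · exact differentiable_eulerProd.comp (by fun_prop)
    · exact differentiable_eulerProd.comp (by fun_prop)
  have hs : sigma = fun z => (1 - Complex.exp (2 * Real.pi * Complex.I * z)) * g z := by
    funext z
    rw [sigma, eulerProd_eq (Complex.exp (2 * Real.pi * Complex.I * z)), hg]
    ring
  have h0 : eulerProd (Real.exp (-2 * Real.pi)) ≠ 0 := eulerProd_ne_zero (by
    rw [norm_exp_neg_two_pi]; exact exp_neg_two_pi_lt_one)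
  have hd := (hW.mul (hgd 0).hasDerivAt).deriv
  rw [hs]
  refine ne_of_eq_of_ne hd ?_
  simp only [hg, mul_zero, Complex.exp_zero, neg_zero, mul_one, sub_self, zero_mul, add_zero]
  simp [-neg_mul, h0, Real.pi_ne_zero, -Complex.ofReal_exp]

theorem deriv_sigma_ne_zero {z : ℂ} (hz : sigma z = 0) : deriv sigma z ≠ 0 := by
  obtain ⟨k, j, rfl⟩ := (sigma_eq_zero_iff z).mp hz
  have h1 := (iff_add_int (P := fun w => sigma w = 0 ∧ deriv sigma w ≠ 0) (a := 1)
    (deriv_ne_zero_of_quasiperiodic differentiable_sigma (by fun_prop)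
      (fun w => neg_ne_zero.mpr (Complex.exp_ne_zero _)) sigma_add_one) 0 k).mpr
    ⟨sigma_zero, deriv_sigma_zero_ne⟩
  have h2 := (iff_add_int (P := fun w => sigma w = 0 ∧ deriv sigma w ≠ 0) (a := Complex.I)
    (deriv_ne_zero_of_quasiperiodic differentiable_sigma (by fun_prop)
      (fun w => neg_ne_zero.mpr (Complex.exp_ne_zero _)) sigma_add_I) (0 + k * 1) j).mpr h1
  simpa using h2.2

/-- `τ` is an entire function with simple zeros, in the points of `Z`, whose modulus is that of
`e^{mπ|z|²/2}` up to bounded factors away from `Z`. -/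
structure IsSigmaLike (τ : ℂ → ℂ) (Z : Set ℂ) (m c C : ℝ) : Prop where
  differentiable : Differentiable ℂ τ
  eq_zero_iff : ∀ z, τ z = 0 ↔ z ∈ Z
  deriv_ne_zero : ∀ z, τ z = 0 → deriv τ z ≠ 0
  pos : 0 < c
  norm_le : ∀ z, ‖τ z‖ ≤ C * Real.exp (m * (Real.pi * ‖z‖ ^ 2 / 2))
  le_norm : ∀ z, (∀ w ∈ Z, 1 / 4 ≤ dist z w) → c * Real.exp (m * (Real.pi * ‖z‖ ^ 2 / 2)) ≤ ‖τ z‖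

/-- By double periodicity, compactness of one period square suffices; there the origin is the only
zero, and the quarter disc about it is removed for the lower bound. -/
theorem exists_sigmaMod_bounds : ∃ c C : ℝ, 0 < c ∧ (∀ z, sigmaMod z ≤ C) ∧
    ∀ z, (∀ w ∈ lattice, 1 / 4 ≤ dist z w) → c ≤ sigmaMod z := by
  have hK : IsCompact ((Set.Icc (-1 / 2 : ℝ) (1 / 2)) ×ℂ (Set.Icc (-1 / 2 : ℝ) (1 / 2))) :=
    isCompact_Icc.reProdIm isCompact_Icc
  have hmem : ∀ w : ℂ, |w.re| ≤ 1 / 2 → |w.im| ≤ 1 / 2 →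
      w ∈ (Set.Icc (-1 / 2 : ℝ) (1 / 2)) ×ℂ (Set.Icc (-1 / 2 : ℝ) (1 / 2)) := by
    intro w h1 h2
    rw [abs_le] at h1 h2
    exact ⟨⟨by linarith, h1.2⟩, ⟨by linarith, h2.2⟩⟩
  obtain ⟨C, hC⟩ := hK.exists_bound_of_continuousOn continuous_sigmaMod.continuousOn
  set K' := ((Set.Icc (-1 / 2 : ℝ) (1 / 2)) ×ℂ (Set.Icc (-1 / 2 : ℝ) (1 / 2))) \
    Metric.ball 0 (1 / 4) with hK'
  have hK'c : IsCompact K' := hK.diff Metric.isOpen_ball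
  have hpos : ∀ w ∈ K', 0 < sigmaMod w := by
    intro w hw
    refine lt_of_le_of_ne (mul_nonneg (norm_nonneg _) (Real.exp_pos _).le) fun h => hw.2 ?_
    have h1 : |w.re| ≤ 1 / 2 := abs_le.mpr ⟨by linarith [hw.1.1.1], hw.1.1.2⟩
    have h2 : |w.im| ≤ 1 / 2 := abs_le.mpr ⟨by linarith [hw.1.2.1], hw.1.2.2⟩
    rw [eq_zero_of_sigma_eq_zero h1 h2 ((sigmaMod_eq_zero_iff w).mp h.symm)]
    simp
  obtain ⟨c, hc0, hc⟩ : ∃ c, 0 < c ∧ ∀ w ∈ K', c ≤ sigmaMod w := by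
    rcases K'.eq_empty_or_nonempty with h | h
    · exact ⟨1, one_pos, by simp [h]⟩
    · obtain ⟨w, hw, hmin⟩ := hK'c.exists_isMinOn h continuous_sigmaMod.continuousOn
      exact ⟨_, hpos w hw, fun v hv => hmin hv⟩
  refine ⟨c, C, hc0, fun z => ?_, fun z hz => ?_⟩
  · obtain ⟨w, k, j, rfl, h1, h2⟩ := exists_lattice_translate z
    rw [sigmaMod_add_lattice]
    exact (le_abs_self _).trans (hC w (hmem w h1 h2))
  · obtain ⟨w, k, j, rfl, h1, h2⟩ := exists_lattice_translate z
    rw [sigmaMod_add_lattice]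
    refine hc w ⟨hmem w h1 h2, fun hw => ?_⟩
    have := hz (k + j * Complex.I) ⟨k, j, rfl⟩
    rw [dist_eq_norm, add_sub_cancel_right] at this
    rw [mem_ball_zero_iff] at hw
    linarith

theorem norm_sigma (z : ℂ) : ‖sigma z‖ = sigmaMod z * Real.exp (Real.pi * ‖z‖ ^ 2 / 2) := by
  rw [sigmaMod, mul_assoc, ← Real.exp_add]; simp

theorem exists_isSigmaLike_sigma : ∃ c C : ℝ, IsSigmaLike sigma lattice 1 c C := by
  obtain ⟨c, C, hc, h1, h2⟩ := exists_sigmaMod_bounds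
  refine ⟨c, C, differentiable_sigma, sigma_eq_zero_iff, fun z => deriv_sigma_ne_zero, hc,
    fun z => ?_, fun z hz => ?_⟩
  · rw [norm_sigma, one_mul]
    gcongr
    exact h1 z
  · rw [norm_sigma, one_mul]
    gcongr
    exact h2 z hz

theorem mem_sharpLattice_iff (z : ℂ) : z ∈ sharpLattice ↔ z - sharp ∈ lattice :=
  ⟨fun ⟨w, hw, h⟩ => by rwa [h, add_sub_cancel_right], fun h => ⟨_, h, by ring⟩⟩

theorem half_le_dist_of_mem_lattice {z w : ℂ} (hz : z ∈ lattice) (hw : w ∈ lattice)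
    (h : z ≠ w) : 1 / 2 ≤ dist z w := by
  obtain ⟨k, j, rfl⟩ := hz
  obtain ⟨k', j', rfl⟩ := hw
  rw [dist_eq_norm]
  by_cases hk : k = k'
  · have hj : j - j' ≠ 0 := fun hj => h (by rw [hk, sub_eq_zero.mp hj])
    refine le_trans ?_ (Complex.abs_im_le_norm _)
    have : (1 : ℝ) ≤ |((j - j' : ℤ) : ℝ)| := by exact_mod_cast Int.one_le_abs hj
    simp only [Complex.sub_im, Complex.add_im, Complex.intCast_im, Complex.mul_im,
      Complex.intCast_re, Complex.I_im, Complex.I_re]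
    push_cast at this
    norm_num
    linarith
  · refine le_trans ?_ (Complex.abs_re_le_norm _)
    have : (1 : ℝ) ≤ |((k - k' : ℤ) : ℝ)| := by exact_mod_cast Int.one_le_abs (sub_ne_zero.mpr hk)
    simp only [Complex.sub_re, Complex.add_re, Complex.intCast_im, Complex.mul_re,
      Complex.intCast_re, Complex.I_im, Complex.I_re]
    push_cast at this
    norm_num
    linarith

theorem half_le_dist_sharp {z w : ℂ} (hz : z ∈ lattice) (hw : w ∈ sharpLattice) :
    1 / 2 ≤ dist z w := by
  obtain ⟨k, j, rfl⟩ := hz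
  obtain ⟨_, ⟨k', j', rfl⟩, rfl⟩ := hw
  rw [dist_eq_norm]
  refine le_trans ?_ (Complex.abs_re_le_norm _)
  have h1 : ((2 * (k - k') - 1 : ℤ)) ≠ 0 := by omega
  have : (1 : ℝ) ≤ |((2 * (k - k') - 1 : ℤ) : ℝ)| := by exact_mod_cast Int.one_le_abs h1
  have e : (((k : ℂ) + j * Complex.I) - ((k' : ℂ) + j' * Complex.I + sharp)).re
      = (((2 * (k - k') - 1 : ℤ) : ℝ)) / 2 := by
    simp [sharp]; ring
  rw [e, abs_div, abs_two]
  linarith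

theorem half_le_dist_of_mem_union {z w : ℂ} (hz : z ∈ lattice ∪ sharpLattice)
    (hw : w ∈ lattice ∪ sharpLattice) (h : z ≠ w) : 1 / 2 ≤ dist z w := by
  rcases hz with hz | hz <;> rcases hw with hw | hw
  · exact half_le_dist_of_mem_lattice hz hw h
  · exact half_le_dist_sharp hz hw
  · rw [dist_comm]; exact half_le_dist_sharp hw hz
  · rw [mem_sharpLattice_iff] at hz hw
    rw [← dist_sub_right z w sharp]
    exact half_le_dist_of_mem_lattice hz hw (fun h' => h (by simpa using h'))

/-- A `sigma`-like function with the zeros `Λ ∪ (Λ + ♯)`. -/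
def sigmaPair (z : ℂ) : ℂ :=
  sigma z * (sigma (z - sharp) * Complex.exp (Real.pi * (starRingEnd ℂ) sharp * z))

/-- The exponential factor in `sigmaPair` corrects the growth `e^{π|z - ♯|²/2}` of the translated
`sigma` to `e^{π|z|²/2}`, up to a constant. -/
theorem norm_sigmaPair (z : ℂ) : ‖sigmaPair z‖ = sigmaMod z * sigmaMod (z - sharp) *
    Real.exp (Real.pi * ‖sharp‖ ^ 2 / 2) * Real.exp (2 * (Real.pi * ‖z‖ ^ 2 / 2)) := by
  have e : (Real.pi * (starRingEnd ℂ) sharp * z).re =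
      Real.pi * (‖z‖ ^ 2 + ‖sharp‖ ^ 2 - ‖z - sharp‖ ^ 2) / 2 := by
    have : ‖z - sharp‖ ^ 2 = ‖z‖ ^ 2 - 2 * ((starRingEnd ℂ) sharp * z).re + ‖sharp‖ ^ 2 := by
      simp only [Complex.sq_norm, Complex.normSq_apply, Complex.sub_re, Complex.sub_im,
        Complex.mul_re, Complex.conj_re, Complex.conj_im]
      ring
    rw [mul_assoc, Complex.re_ofReal_mul, this]; ring
  rw [sigmaPair, norm_mul, norm_mul, norm_sigma, norm_sigma, Complex.norm_exp, e]
  calc _ = sigmaMod z * sigmaMod (z - sharp) * (Real.exp (Real.pi * ‖z‖ ^ 2 / 2) *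
      (Real.exp (Real.pi * ‖z - sharp‖ ^ 2 / 2) *
        Real.exp (Real.pi * (‖z‖ ^ 2 + ‖sharp‖ ^ 2 - ‖z - sharp‖ ^ 2) / 2))) := by ring
    _ = _ := by
      rw [← Real.exp_add, ← Real.exp_add, mul_assoc _ (Real.exp _), ← Real.exp_add]
      congr 2; ring

theorem sigmaPair_eq_zero_iff (z : ℂ) : sigmaPair z = 0 ↔ z ∈ lattice ∪ sharpLattice := by
  rw [sigmaPair, mul_eq_zero, mul_eq_zero, sigma_eq_zero_iff, sigma_eq_zero_iff,
    or_iff_left (Complex.exp_ne_zero _), Set.mem_union, mem_sharpLattice_iff]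

theorem exists_isSigmaLike_sigmaPair :
    ∃ c C : ℝ, IsSigmaLike sigmaPair (lattice ∪ sharpLattice) 2 c C := by
  obtain ⟨c, C, hc, h1, h2⟩ := exists_sigmaMod_bounds
  have hnn : ∀ z, 0 ≤ sigmaMod z := fun z => mul_nonneg (norm_nonneg _) (Real.exp_pos _).le
  have hC : 0 ≤ C := (hnn 0).trans (h1 0)
  have hs2 : Differentiable ℂ fun z => sigma (z - sharp) :=
    differentiable_sigma.comp (by fun_prop)
  have he : Differentiable ℂ fun z : ℂ => Complex.exp (Real.pi * (starRingEnd ℂ) sharp * z) := by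
    fun_prop
  refine ⟨c * c * Real.exp (Real.pi * ‖sharp‖ ^ 2 / 2), C * C *
    Real.exp (Real.pi * ‖sharp‖ ^ 2 / 2), differentiable_sigma.mul (hs2.mul he),
    sigmaPair_eq_zero_iff, fun z hz => ?_, by positivity, fun z => ?_, fun z hz => ?_⟩
  · have hd : deriv sigmaPair z = deriv sigma z * (sigma (z - sharp) *
        Complex.exp (Real.pi * (starRingEnd ℂ) sharp * z)) +
        sigma z * (deriv sigma (z - sharp) * Complex.exp (Real.pi * (starRingEnd ℂ) sharp * z) +
          sigma (z - sharp) *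
            deriv (fun z : ℂ => Complex.exp (Real.pi * (starRingEnd ℂ) sharp * z)) z) := by
      have := (differentiable_sigma z).hasDerivAt.mul ((hs2 z).hasDerivAt.mul (he z).hasDerivAt)
      rw [deriv_comp_sub_const] at this
      exact this.deriv
    rw [sigmaPair_eq_zero_iff] at hz
    rcases hz with hz | hz
    · have h0 := (sigma_eq_zero_iff z).mpr hz
      have h3 : sigma (z - sharp) ≠ 0 := fun h => by
        have := half_le_dist_sharp hz ((mem_sharpLattice_iff z).mpr ((sigma_eq_zero_iff _).mp h))
        rw [dist_self] at this; norm_num at this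
      rw [hd, h0, zero_mul, add_zero]
      exact mul_ne_zero (deriv_sigma_ne_zero h0) (mul_ne_zero h3 (Complex.exp_ne_zero _))
    · have h0 := (sigma_eq_zero_iff _).mpr ((mem_sharpLattice_iff z).mp hz)
      have h3 : sigma z ≠ 0 := fun h => by
        have := half_le_dist_sharp ((sigma_eq_zero_iff _).mp h) hz
        rw [dist_self] at this; norm_num at this
      rw [hd, h0, zero_mul, zero_mul, mul_zero, zero_add, add_zero]
      exact mul_ne_zero h3 (mul_ne_zero (deriv_sigma_ne_zero h0) (Complex.exp_ne_zero _))
  · rw [norm_sigmaPair]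
    gcongr
    · exact hnn _
    · exact h1 _
    · exact h1 _
  · rw [norm_sigmaPair]
    gcongr
    · exact hnn _
    · exact h2 z fun w hw => hz w (Or.inl hw)
    · refine h2 _ fun w hw => ?_
      have := hz (w + sharp) (Or.inr ⟨w, hw, rfl⟩)
      rwa [← dist_sub_right _ _ sharp, add_sub_cancel_right] at this

end Gabor

end

/-! ### The Cauchy-Pompeiu inequality for cut-off holomorphic functions. -/

noncomputable section

namespace Gabor

open scoped ENNReal Topology

/-- Polar coordinates around `z`. -/
def polarMap (z : ℂ) (p : ℝ × ℝ) : ℂ := z + p.1 * Complex.exp (p.2 * Complex.I)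

theorem continuous_polarMap (z : ℂ) : Continuous (polarMap z) := by
  unfold polarMap; fun_prop

theorem exists_hasFDerivAt_polarMap (z : ℂ) (p : ℝ × ℝ) : ∃ L : ℝ × ℝ →L[ℝ] ℂ,
    HasFDerivAt (polarMap z) L p ∧ L (1, 0) = Complex.exp (p.2 * Complex.I) ∧
      L (0, 1) = p.1 * (Complex.I * Complex.exp (p.2 * Complex.I)) := by
  have h1 : HasFDerivAt (fun p : ℝ × ℝ => (p.1 : ℂ))
      (Complex.ofRealCLM.comp (ContinuousLinearMap.fst ℝ ℝ ℝ)) p :=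
    Complex.ofRealCLM.hasFDerivAt.comp p hasFDerivAt_fst
  have h2 : HasFDerivAt (fun p : ℝ × ℝ => (p.2 : ℂ))
      (Complex.ofRealCLM.comp (ContinuousLinearMap.snd ℝ ℝ ℝ)) p :=
    Complex.ofRealCLM.hasFDerivAt.comp p hasFDerivAt_snd
  refine ⟨_, (h1.mul ((h2.mul_const Complex.I).cexp)).const_add z, ?_, ?_⟩
  · simp
  · simp [mul_comm]

section

variable {Ω : Set ℂ} {P : ℂ → ℂ} {χ : ℂ → ℝ}

/-- `P` is controlled only on `Ω`, but off the support of `χ` both the product and the derivative of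
`χ` vanish locally, so the product rule holds everywhere. -/
theorem hasFDerivAt_mul_of_tsupport (hΩ : IsOpen Ω) (hP : DifferentiableOn ℂ P Ω)
    (hχ : ContDiff ℝ 1 χ) (hs : tsupport χ ⊆ Ω) (z : ℂ) : ∃ L : ℂ →L[ℝ] ℂ,
    HasFDerivAt (fun z => (χ z : ℂ) * P z) L z ∧
      ∀ v, L v = fderiv ℝ χ z v * P z + χ z * deriv P z * v := by
  have h1 : HasFDerivAt (fun z => (χ z : ℂ)) (Complex.ofRealCLM.comp (fderiv ℝ χ z)) z :=
    Complex.ofRealCLM.hasFDerivAt.comp z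
      (hχ.differentiable one_ne_zero).differentiableAt.hasFDerivAt
  by_cases hz : z ∈ tsupport χ
  · have h2 : HasFDerivAt P ((deriv P z) • (1 : ℂ →L[ℝ] ℂ)) z :=
      ((hP.differentiableAt (hΩ.mem_nhds (hs hz))).hasDerivAt).complexToReal_fderiv
    refine ⟨_, h1.mul h2, fun v => ?_⟩
    simp; ring
  · have h0 : χ =ᶠ[𝓝 z] 0 := notMem_tsupport_iff_eventuallyEq.mp hz
    refine ⟨0, ?_, fun v => ?_⟩
    · refine (hasFDerivAt_const (0 : ℂ) z).congr_of_eventuallyEq ?_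
      filter_upwards [h0] with w hw
      simp [hw]
    · have : fderiv ℝ χ z = 0 := by
        rw [h0.fderiv_eq]; exact fderiv_const_apply 0
      simp [this, h0.eq_of_nhds]

theorem continuous_smul_fderiv (hΩ : IsOpen Ω) (hP : DifferentiableOn ℂ P Ω)
    (hχ : ContDiff ℝ 1 χ) (hs : tsupport χ ⊆ Ω) :
    Continuous fun w : ℂ => P w • (Complex.ofRealCLM.comp (fderiv ℝ χ w)) := by
  rw [continuous_iff_continuousAt]
  intro w
  have hd : ContinuousAt (fun w : ℂ => (Complex.ofRealCLM.comp (fderiv ℝ χ w))) w :=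
    (continuous_const.clm_comp (hχ.continuous_fderiv one_ne_zero)).continuousAt
  by_cases hw : w ∈ tsupport χ
  · exact (hP.differentiableAt (hΩ.mem_nhds (hs hw))).continuousAt.smul hd
  · have h0 : χ =ᶠ[𝓝 w] 0 := notMem_tsupport_iff_eventuallyEq.mp hw
    have : (fun w : ℂ => P w • (Complex.ofRealCLM.comp (fderiv ℝ χ w))) =ᶠ[𝓝 w]
        fun _ => 0 := by
      filter_upwards [h0.eventuallyEq_nhds] with v hv
      have : fderiv ℝ χ v = 0 := by rw [hv.fderiv_eq]; exact fderiv_const_apply 0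
      ext u
      simp [this]
    exact continuousAt_const.congr this.symm

theorem measurable_enorm_mul_enorm_fderiv (hΩ : IsOpen Ω) (hP : DifferentiableOn ℂ P Ω)
    (hχ : ContDiff ℝ 1 χ) (hs : tsupport χ ⊆ Ω) :
    Measurable fun w : ℂ => ‖P w‖ₑ * ‖fderiv ℝ χ w‖ₑ := by
  have h : ∀ w, ‖P w‖ₑ * ‖fderiv ℝ χ w‖ₑ = ‖P w • (Complex.ofRealCLM.comp (fderiv ℝ χ w))‖ₑ := by
    intro w
    rw [enorm_smul]
    congr 1
    exact enorm_eq_iff_norm_eq.mpr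
      (LinearIsometry.norm_toContinuousLinearMap_comp Complex.ofRealLI (g := fderiv ℝ χ w)).symm
  simp_rw [h]
  exact (continuous_smul_fderiv hΩ hP hχ hs).measurable.enorm

/-- In polar coordinates `∂_r + (i/r) ∂_θ` is a multiple of the Cauchy-Riemann operator, so it
annihilates `P` and falls on `χ` alone. The divergence theorem for `(χP, (i/r) χP)` on a rectangle
leaves one edge: the sides `θ = ±π` cancel and the side at `R` lies where `χ` vanishes. -/
theorem integral_polar_dbar (hΩ : IsOpen Ω) (hP : DifferentiableOn ℂ P Ω)
    (hχ : ContDiff ℝ 1 χ) (hs : tsupport χ ⊆ Ω) (z : ℂ) {ε R : ℝ} (hε : 0 < ε) (hεR : ε ≤ R)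
    (hR : ∀ w, R ≤ dist w z → χ w = 0) :
    ∫ x in ε..R, ∫ y in (-Real.pi)..Real.pi, P (polarMap z (x, y)) *
      (fderiv ℝ χ (polarMap z (x, y)) (Complex.exp (y * Complex.I)) +
        Complex.I * fderiv ℝ χ (polarMap z (x, y)) (Complex.I * Complex.exp (y * Complex.I))) =
    -∫ y in (-Real.pi)..Real.pi, (χ (polarMap z (ε, y)) : ℂ) * P (polarMap z (ε, y)) := by
  choose L hL hL1 hL2 using exists_hasFDerivAt_polarMap z
  choose M hM hM' using hasFDerivAt_mul_of_tsupport hΩ hP hχ hs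
  set Φ : ℂ → ℂ := fun z => (χ z : ℂ) * P z with hΦ
  have hΦc : Continuous Φ := continuous_iff_continuousAt.mpr fun w => (hM w).continuousAt
  have hi : ∀ p : ℝ × ℝ, p.1 ≠ 0 → HasFDerivAt (fun p : ℝ × ℝ => Complex.I * ((p.1⁻¹ : ℝ) : ℂ))
      (Complex.I • (Complex.ofRealCLM.comp
        ((-(p.1 ^ 2)⁻¹) • (ContinuousLinearMap.fst ℝ ℝ ℝ)))) p := fun p hp =>
    (Complex.ofRealCLM.hasFDerivAt.comp p
      ((hasDerivAt_inv hp).comp_hasFDerivAt p hasFDerivAt_fst)).const_mul Complex.I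
  have hf : ∀ p, HasFDerivAt (fun p => Φ (polarMap z p)) ((M (polarMap z p)).comp (L p)) p :=
    fun p => (hM _).comp p (hL p)
  have hsum : ∀ x y : ℝ, x ≠ 0 → ((M (polarMap z (x, y))).comp (L (x, y))) (1, 0) +
      ((Complex.I * ((x⁻¹ : ℝ) : ℂ)) • (M (polarMap z (x, y))).comp (L (x, y)) +
        Φ (polarMap z (x, y)) • (Complex.I • (Complex.ofRealCLM.comp
        ((-(x ^ 2)⁻¹) • (ContinuousLinearMap.fst ℝ ℝ ℝ))))) (0, 1) =
      P (polarMap z (x, y)) *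
      (fderiv ℝ χ (polarMap z (x, y)) (Complex.exp (y * Complex.I)) +
        Complex.I * fderiv ℝ χ (polarMap z (x, y)) (Complex.I * Complex.exp (y * Complex.I))) := by
    intro x y hx
    have hx' : (x : ℂ) ≠ 0 := by exact_mod_cast hx
    have e : fderiv ℝ χ (polarMap z (x, y)) (x * (Complex.I * Complex.exp (y * Complex.I)))
        = x * fderiv ℝ χ (polarMap z (x, y)) (Complex.I * Complex.exp (y * Complex.I)) := by
      rw [← Complex.real_smul, map_smul, smul_eq_mul]
    simp only [add_apply, smul_apply,
      ContinuousLinearMap.comp_apply, hL1, hL2, hM', e, ContinuousLinearMap.coe_fst', smul_eq_mul]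
    push_cast
    have e3 : Complex.ofRealCLM (-(x ^ 2)⁻¹ * 0) = 0 := by simp
    rw [e3]
    field_simp
    linear_combination (χ (polarMap z (x, y)) * deriv P (polarMap z (x, y)) *
      Complex.exp (y * Complex.I)) * Complex.I_mul_I
  have hcont : Continuous fun p : ℝ × ℝ => P (polarMap z p) *
      (fderiv ℝ χ (polarMap z p) (Complex.exp (p.2 * Complex.I)) +
        Complex.I * fderiv ℝ χ (polarMap z p) (Complex.I * Complex.exp (p.2 * Complex.I))) := by
    have h1 := continuous_smul_fderiv hΩ hP hχ hs
    have h2 := h1.comp (continuous_polarMap z)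
    have h3 : Continuous fun p : ℝ × ℝ => Complex.exp (p.2 * Complex.I) := by fun_prop
    have h4 := (h2.clm_apply h3).add ((h2.clm_apply ((continuous_const (y := Complex.I)).mul h3)).const_smul Complex.I)
    refine h4.congr fun p => ?_
    simp; ring
  have hx0 : ∀ x ∈ Set.uIcc ε R, x ≠ 0 := fun x hx => by
    rw [Set.uIcc_of_le hεR] at hx; linarith [hx.1]
  have key := integral2_divergence_prod_of_hasFDerivAt (fun p => Φ (polarMap z p))
    (fun p => (Complex.I * ((p.1⁻¹ : ℝ) : ℂ)) * Φ (polarMap z p))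
    (fun p => (M (polarMap z p)).comp (L p))
    (fun p => (Complex.I * ((p.1⁻¹ : ℝ) : ℂ)) • (M (polarMap z p)).comp (L p) +
        Φ (polarMap z p) • (Complex.I • (Complex.ofRealCLM.comp
        ((-(p.1 ^ 2)⁻¹) • (ContinuousLinearMap.fst ℝ ℝ ℝ)))))
    ε (-Real.pi) R Real.pi (hΦc.comp (continuous_polarMap z)).continuousOn
    (fun p hp => ((hi p (hx0 _ hp.1)).continuousAt.mul (hf p).continuousAt).continuousWithinAt)
    (fun p _ => hf p) (fun p hp => (hi p ?_).mul (hf p)) ?_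
  · have e1 : ∀ x : ℝ, polarMap z (x, Real.pi) = polarMap z (x, -Real.pi) := fun x => by
      simp only [polarMap, Complex.ofReal_neg, neg_mul, Complex.exp_neg, Complex.exp_pi_mul_I]
      norm_num
    have e2 : ∀ y : ℝ, Φ (polarMap z (R, y)) = 0 := fun y => by
      have : χ (polarMap z (R, y)) = 0 := hR _ (by
        simp only [polarMap, dist_eq_norm, add_sub_cancel_left, norm_mul, Complex.norm_real,
          Complex.norm_exp_ofReal_mul_I, mul_one]
        exact le_abs_self R)
      simp [hΦ, this]
    simp only [e1, e2, sub_self, intervalIntegral.integral_zero, zero_sub, add_zero] at key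
    rw [← key]
    refine intervalIntegral.integral_congr fun x hx => ?_
    refine intervalIntegral.integral_congr fun y _ => ?_
    exact (hsum x y (hx0 x hx)).symm
  · rw [min_eq_left hεR] at hp
    linarith [hp.1.1]
  · refine (hcont.continuousOn.integrableOn_compact
      (isCompact_uIcc.prod isCompact_uIcc)).congr_fun (fun p hp => ?_)
      (measurableSet_uIcc.prod measurableSet_uIcc)
    exact (hsum p.1 p.2 (hx0 _ hp.1)).symm

/-- A form of the Cauchy-Pompeiu inequality: cutting off a holomorphic function costs its
integral over the zone of the cutoff, against the Cauchy kernel. -/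
theorem enorm_mul_le_lintegral (hΩ : IsOpen Ω) (hP : DifferentiableOn ℂ P Ω)
    (hχ : ContDiff ℝ 1 χ) (hc : HasCompactSupport χ) (hs : tsupport χ ⊆ Ω) (z : ℂ) :
    ‖(χ z : ℂ) * P z‖ₑ ≤ ∫⁻ w, ‖P w‖ₑ * ‖fderiv ℝ χ w‖ₑ * ‖w - z‖ₑ⁻¹ := by
  set J := ∫⁻ w, ‖P w‖ₑ * ‖fderiv ℝ χ w‖ₑ * ‖w - z‖ₑ⁻¹ with hJ
  obtain ⟨R, hR0, hR⟩ : ∃ R, 0 < R ∧ ∀ w, R ≤ dist w z → χ w = 0 := by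
    obtain ⟨R, hR⟩ := hc.isCompact.isBounded.subset_ball z
    refine ⟨max R 1, by positivity, fun w hw => image_eq_zero_of_notMem_tsupport fun h => ?_⟩
    have := hR h
    rw [Metric.mem_ball] at this
    linarith [le_max_left R 1]
  have hΦc : Continuous fun w => (χ w : ℂ) * P w := continuous_iff_continuousAt.mpr fun w =>
    (hasFDerivAt_mul_of_tsupport hΩ hP hχ hs w).choose_spec.1.continuousAt
  have hexp : ∀ y : ℝ, ‖Complex.exp (y * Complex.I)‖ₑ = 1 := fun y => by
    rw [← ofReal_norm, Complex.norm_exp_ofReal_mul_I, ENNReal.ofReal_one]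
  have hI : ‖Complex.I‖ₑ = 1 := by rw [← ofReal_norm, Complex.norm_I, ENNReal.ofReal_one]
  -- The Jacobian of polar coordinates cancels the Cauchy kernel. The factor 2 counts the radial and
  -- the tangential derivative of `χ`.
  have hpolar : ∫⁻ p in polarCoord.target,
      2 * (‖P (polarMap z p)‖ₑ * ‖fderiv ℝ χ (polarMap z p)‖ₑ) = 2 * J := by
    rw [hJ, ← lintegral_add_left_eq_self _ z, ← Complex.lintegral_comp_polarCoord_symm,
      ← lintegral_const_mul' _ _ (by simp)]
    refine setLIntegral_congr_fun polarCoord.open_target.measurableSet fun p hp => ?_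
    have hp1 : 0 < p.1 := hp.1
    have e : z + Complex.polarCoord.symm p = polarMap z p := by
      rw [Complex.polarCoord_symm_apply, polarMap, Complex.exp_mul_I]; push_cast; rfl
    have e2 : ‖z + Complex.polarCoord.symm p - z‖ₑ = ENNReal.ofReal p.1 := by
      rw [add_sub_cancel_left, ← ofReal_norm, Complex.norm_polarCoord_symm, abs_of_pos hp1]
    simp only [smul_eq_mul]
    rw [e2, e]
    have h0 : ENNReal.ofReal p.1 ≠ 0 := (ENNReal.ofReal_pos.mpr hp1).ne'
    calc _ = 2 * (‖P (polarMap z p)‖ₑ * ‖fderiv ℝ χ (polarMap z p)‖ₑ) *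
          (ENNReal.ofReal p.1 * (ENNReal.ofReal p.1)⁻¹) := by
          rw [ENNReal.mul_inv_cancel h0 ENNReal.ofReal_ne_top, mul_one]
      _ = _ := by ring
  have hbound : ∀ ε, 0 < ε → ε < R →
      ‖∫ y in (-Real.pi)..Real.pi, (χ (polarMap z (ε, y)) : ℂ) * P (polarMap z (ε, y))‖ₑ
        ≤ 2 * J := by
    intro ε hε hεR
    rw [← enorm_neg, ← integral_polar_dbar hΩ hP hχ hs z hε hεR.le hR,
      intervalIntegral.integral_of_le hεR.le]
    refine (enorm_integral_le_lintegral_enorm _).trans ?_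
    have hpi : -Real.pi ≤ Real.pi := by linarith [Real.pi_pos]
    have hm : Measurable fun p : ℝ × ℝ =>
        2 * (‖P (polarMap z p)‖ₑ * ‖fderiv ℝ χ (polarMap z p)‖ₑ) := by
      exact ((measurable_enorm_mul_enorm_fderiv hΩ hP hχ hs).comp
        (continuous_polarMap z).measurable).const_mul 2
    calc _ ≤ ∫⁻ x in Set.Ioc ε R, ∫⁻ y in Set.Ioc (-Real.pi) Real.pi,
          2 * (‖P (polarMap z (x, y))‖ₑ * ‖fderiv ℝ χ (polarMap z (x, y))‖ₑ) := by
          refine lintegral_mono fun x => ?_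
          rw [intervalIntegral.integral_of_le hpi]
          refine (enorm_integral_le_lintegral_enorm _).trans (lintegral_mono fun y => ?_)
          rw [enorm_mul, mul_comm 2, mul_assoc]
          gcongr
          have ha : ∀ v : ℂ, ‖v‖ₑ = 1 → ‖((fderiv ℝ χ (polarMap z (x, y)) v : ℝ) : ℂ)‖ₑ ≤
              ‖fderiv ℝ χ (polarMap z (x, y))‖ₑ := fun v hv => by
            have h1 : ‖((fderiv ℝ χ (polarMap z (x, y)) v : ℝ) : ℂ)‖ₑ
                = ‖fderiv ℝ χ (polarMap z (x, y)) v‖ₑ := by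
              rw [← ofReal_norm, Complex.norm_real, ofReal_norm]
            rw [h1]
            simpa [hv] using (fderiv ℝ χ (polarMap z (x, y))).le_opENorm v
          refine (enorm_add_le _ _).trans ?_
          rw [enorm_mul, hI, one_mul, mul_two]
          exact add_le_add (ha _ (hexp y)) (ha _ (by rw [enorm_mul, hI, hexp, one_mul]))
      _ = ∫⁻ p in Set.Ioc ε R ×ˢ Set.Ioc (-Real.pi) Real.pi,
          2 * (‖P (polarMap z p)‖ₑ * ‖fderiv ℝ χ (polarMap z p)‖ₑ) := by
          rw [Measure.volume_eq_prod, setLIntegral_prod _ hm.aemeasurable]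
      _ = ∫⁻ p in Set.Ioc ε R ×ˢ Set.Ioo (-Real.pi) Real.pi,
          2 * (‖P (polarMap z p)‖ₑ * ‖fderiv ℝ χ (polarMap z p)‖ₑ) := by
          refine setLIntegral_congr ?_
          exact Measure.set_prod_ae_eq (ae_eq_refl _) Ioo_ae_eq_Ioc.symm
      _ ≤ 2 * J := by
          rw [← hpolar]
          refine lintegral_mono_set (Set.prod_mono (fun x hx => ?_) subset_rfl)
          exact hε.trans hx.1
  have hlim : Filter.Tendsto (fun ε : ℝ => ‖∫ y in (-Real.pi)..Real.pi,
      (χ (polarMap z (ε, y)) : ℂ) * P (polarMap z (ε, y))‖ₑ) (𝓝[>] 0)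
      (𝓝 (‖(2 * Real.pi : ℝ) • ((χ z : ℂ) * P z)‖ₑ)) := by
    have hc' : Continuous fun ε : ℝ => ∫ y in (-Real.pi)..Real.pi,
        (χ (polarMap z (ε, y)) : ℂ) * P (polarMap z (ε, y)) :=
      intervalIntegral.continuous_parametric_intervalIntegral_of_continuous'
        (f := fun ε y => (χ (polarMap z (ε, y)) : ℂ) * P (polarMap z (ε, y))) (hΦc.comp (continuous_polarMap z)) _ _
    have h0 := (hc'.enorm.tendsto 0).mono_left (nhdsWithin_le_nhds (s := Set.Ioi 0))
    convert h0 using 3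
    simp [polarMap]
    ring
  have hle := le_of_tendsto hlim (by
    filter_upwards [Ioo_mem_nhdsGT hR0] with ε hε using hbound ε hε.1 hε.2)
  rw [enorm_smul] at hle
  -- The limit `ε → 0` gives `2π` on the left; replacing it by 2 already suffices for the constant
  -- 1.
  have h2 : (2 : ℝ≥0∞) ≤ ‖(2 * Real.pi : ℝ)‖ₑ := by
    rw [← ofReal_norm, Real.norm_of_nonneg (by positivity)]
    rw [show (2 : ℝ≥0∞) = ENNReal.ofReal 2 by simp]
    exact ENNReal.ofReal_le_ofReal (by linarith [Real.pi_gt_three])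
  have h3 : 2 * ‖(χ z : ℂ) * P z‖ₑ ≤ 2 * J := le_trans (by gcongr) hle
  exact (ENNReal.mul_le_mul_iff_right (by simp) (by simp)).mp h3

end

end Gabor

end

/-! ### Sub-mean values, cutoffs and the potential of the weight. -/

noncomputable section

namespace Gabor

open scoped ENNReal Topology Convolution

theorem ContDiffBump.exists_norm_fderiv_le {c : ℂ} (φ : ContDiffBump c) :
    ∃ B : ℝ, ∀ w, ‖fderiv ℝ φ w‖ ≤ B :=
  ((φ.contDiff (n := 1)).continuous_fderiv one_ne_zero).bounded_above_of_compact_support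
    (φ.hasCompactSupport.fderiv ℝ)

/-- The sub-mean value property of `|H|²` for entire functions `H`. -/
theorem exists_enorm_sq_le_lintegral_ball : ∃ A : ℝ≥0∞, A ≠ ∞ ∧ ∀ H : ℂ → ℂ,
    Differentiable ℂ H → ‖H 0‖ₑ ^ 2 ≤ A * ∫⁻ w in Metric.ball 0 1, ‖H w‖ₑ ^ 2 := by
  let φ : ContDiffBump (0 : ℂ) := ⟨1 / 4, 1 / 2, by norm_num, by norm_num⟩
  obtain ⟨B, hB⟩ := ContDiffBump.exists_norm_fderiv_le φ
  refine ⟨ENNReal.ofReal B * 4, ENNReal.mul_ne_top ENNReal.ofReal_ne_top (by simp),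
    fun H hH => ?_⟩
  -- The square is itself holomorphic. The bump is constant for `|w| < 1/4`, so the kernel is at
  -- most 4 where its gradient lives.
  have h := enorm_mul_le_lintegral (P := fun w => H w ^ 2) (χ := φ) isOpen_univ
    (hH.pow 2).differentiableOn φ.contDiff φ.hasCompactSupport (Set.subset_univ _) 0
  rw [φ.one_of_mem_closedBall (Metric.mem_closedBall_self (by norm_num))] at h
  simp only [Complex.ofReal_one, one_mul, enorm_pow, sub_zero] at h
  refine h.trans ?_
  rw [← lintegral_const_mul' _ _ (ENNReal.mul_ne_top ENNReal.ofReal_ne_top (by simp)),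
    ← lintegral_indicator Metric.isOpen_ball.measurableSet]
  refine lintegral_mono fun w => ?_
  by_cases h0 : fderiv ℝ φ w = 0
  · have h1 : ‖fderiv ℝ φ w‖ₑ = 0 := by
      rw [← ofReal_norm, h0, norm_zero, ENNReal.ofReal_zero]
    simp [h1]
  have h1 : w ∈ Metric.ball (0 : ℂ) 1 := by
    have : w ∈ tsupport φ := support_fderiv_subset ℝ h0
    rw [φ.tsupport_eq] at this
    exact Metric.closedBall_subset_ball (by norm_num) this
  have h2 : 1 / 4 ≤ ‖w‖ := by
    by_contra h
    push Not at h
    refine h0 ?_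
    have : φ =ᶠ[𝓝 w] fun _ => (1 : ℝ) := by
      filter_upwards [Metric.isOpen_ball.mem_nhds (mem_ball_zero_iff.mpr h)] with v hv
      exact φ.one_of_mem_closedBall (Metric.ball_subset_closedBall hv)
    rw [this.fderiv_eq]
    exact fderiv_const_apply 1
  rw [Set.indicator_of_mem h1]
  have h3 : ‖fderiv ℝ φ w‖ₑ ≤ ENNReal.ofReal B := by
    rw [← ofReal_norm]; exact ENNReal.ofReal_le_ofReal (hB w)
  have h4 : ‖w‖ₑ⁻¹ ≤ 4 := by
    rw [ENNReal.inv_le_iff_inv_le, ← ofReal_norm,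
      show (4 : ℝ≥0∞)⁻¹ = ENNReal.ofReal (1 / 4) by
        rw [one_div, ENNReal.ofReal_inv_of_pos (by norm_num)]; simp]
    exact ENNReal.ofReal_le_ofReal h2
  calc _ ≤ ‖H w‖ₑ ^ 2 * ENNReal.ofReal B * 4 := by gcongr
    _ = _ := by ring

/-- Smooth cutoff functions at unit scale with uniformly bounded gradient. -/
theorem exists_cutoff : ∃ B : ℝ, ∀ S : Set ℂ, MeasurableSet S → ∃ χ : ℂ → ℝ, ContDiff ℝ 1 χ ∧
    (∀ z, ‖fderiv ℝ χ z‖ ≤ B) ∧ (∀ z, Metric.ball z 1 ⊆ S → χ z = 1) ∧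
    (∀ z, Disjoint (Metric.ball z 1) S → χ z = 0) := by
  let φ : ContDiffBump (0 : ℂ) := ⟨1 / 2, 1, by norm_num, by norm_num⟩
  have hφ : ContDiff ℝ 1 (φ.normed volume) := φ.contDiff_normed
  have hφc : HasCompactSupport (φ.normed volume) := φ.hasCompactSupport_normed
  refine ⟨∫ w, ‖fderiv ℝ (φ.normed volume) w‖, fun S hS => ?_⟩
  have hS' : LocallyIntegrable (S.indicator (fun _ => (1 : ℝ))) volume :=
    (locallyIntegrable_const (1 : ℝ)).indicator hS
  -- Mollifying the indicator of `S`: its gradient is at most the `L¹` norm of the gradient of the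
  -- mollifier, whatever `S` is.
  refine ⟨φ.normed volume ⋆[ContinuousLinearMap.lsmul ℝ ℝ, volume] S.indicator (fun _ => (1 : ℝ)),
    hφc.contDiff_convolution_left _ hφ hS', fun z => ?_, fun z hz => ?_, fun z hz => ?_⟩
  · rw [(hφc.hasFDerivAt_convolution_left _ hφ hS' z).fderiv, convolution]
    refine (norm_integral_le_of_norm_le ?_ (Filter.Eventually.of_forall fun t => ?_))
    · exact ((hφ.continuous_fderiv one_ne_zero).integrable_of_hasCompactSupport
        (hφc.fderiv ℝ)).norm
    · refine ContinuousLinearMap.opNorm_le_bound _ (norm_nonneg _) fun v => ?_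
      simp only [ContinuousLinearMap.precompL_apply, ContinuousLinearMap.lsmul_apply, norm_smul]
      have h1 : ‖S.indicator (fun _ => (1 : ℝ)) (z - t)‖ ≤ 1 :=
        (norm_indicator_le_norm_self _ _).trans (by simp)
      calc _ ≤ ‖fderiv ℝ (φ.normed volume) t v‖ * 1 := by gcongr
        _ ≤ _ := by rw [mul_one]; exact ContinuousLinearMap.le_opNorm _ _
  · have h1 : ∀ x ∈ Metric.ball z φ.rOut, S.indicator (fun _ => (1 : ℝ)) x = 1 := fun x hx =>
      Set.indicator_of_mem (hz hx) _
    have h2 := h1 z (Metric.mem_ball_self φ.rOut_pos)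
    rw [φ.normed_convolution_eq_right fun x hx => (h1 x hx).trans h2.symm, h2]
  · have h1 : ∀ x ∈ Metric.ball z φ.rOut, S.indicator (fun _ => (1 : ℝ)) x = 0 := fun x hx =>
      Set.indicator_of_notMem (fun h => Set.disjoint_left.mp hz hx h) _
    have h2 := h1 z (Metric.mem_ball_self φ.rOut_pos)
    rw [φ.normed_convolution_eq_right fun x hx => (h1 x hx).trans h2.symm, h2]

/-- The weight `(|z|^δ + 1)⁻¹`. -/
def weight (δ : ℝ) (z : ℂ) : ℝ≥0∞ := (ENNReal.ofReal (‖z‖ ^ δ + 1))⁻¹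

theorem measurable_weight (δ : ℝ) : Measurable (weight δ) := by
  unfold weight
  have : Measurable fun z : ℂ => ‖z‖ ^ δ := measurable_norm.pow_const δ
  exact ((this.add_const 1).ennreal_ofReal).inv

theorem weight_mono {δ : ℝ} (hδ : 0 ≤ δ) {z w : ℂ} (h : ‖w‖ ≤ ‖z‖) : weight δ z ≤ weight δ w := by
  unfold weight
  gcongr

theorem weight_le_one {δ : ℝ} (z : ℂ) : weight δ z ≤ 1 := by
  rw [weight, ENNReal.inv_le_one, ENNReal.one_le_ofReal]
  linarith [Real.rpow_nonneg (norm_nonneg z) δ]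

/-- In polar coordinates the Jacobian cancels `|z|⁻¹`, leaving `∫ dr / (r^δ + 1)`, finite exactly
because `δ > 1`. -/
theorem lintegral_weight_div_norm_lt_top {δ : ℝ} (hδ : 1 < δ) :
    ∫⁻ z : ℂ, weight δ z * ‖z‖ₑ⁻¹ < ∞ := by
  rw [← Complex.lintegral_comp_polarCoord_symm]
  have hb : ∀ x : ℝ, 0 < x → (ENNReal.ofReal (x ^ δ + 1))⁻¹ ≤
      ENNReal.ofReal (2 ^ δ) * ENNReal.ofReal ((1 + ‖x‖) ^ (-δ)) := by
    intro x hx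
    rw [Real.norm_of_nonneg hx.le, ← ENNReal.ofReal_inv_of_pos (by positivity),
      ← ENNReal.ofReal_mul (by positivity), Real.rpow_neg (by positivity)]
    refine ENNReal.ofReal_le_ofReal ?_
    rw [← div_eq_mul_inv, inv_le_comm₀ (by positivity) (by positivity), inv_div,
      ← Real.div_rpow (by positivity) (by positivity)]
    rcases le_total x 1 with h | h
    · have : ((1 + x) / 2) ^ δ ≤ 1 := Real.rpow_le_one (by positivity) (by linarith) (by linarith)
      linarith [Real.rpow_nonneg hx.le δ]
    · have : ((1 + x) / 2) ^ δ ≤ x ^ δ :=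
        Real.rpow_le_rpow (by positivity) (by linarith) (by linarith)
      linarith
  calc _ ≤ ∫⁻ p in polarCoord.target, ENNReal.ofReal (2 ^ δ) *
        ENNReal.ofReal ((1 + ‖p.1‖) ^ (-δ)) := by
        refine setLIntegral_mono' polarCoord.open_target.measurableSet fun p hp => ?_
        have hp1 : 0 < p.1 := hp.1
        rw [weight, ← ofReal_norm, Complex.norm_polarCoord_symm, abs_of_pos hp1, smul_eq_mul,
          mul_left_comm, ENNReal.mul_inv_cancel (ENNReal.ofReal_pos.mpr hp1).ne'
          ENNReal.ofReal_ne_top, mul_one]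
        exact hb p.1 hp1
    _ = ∫⁻ x in Set.Ioi (0 : ℝ), ∫⁻ y in Set.Ioo (-Real.pi) Real.pi, ENNReal.ofReal (2 ^ δ) *
        ENNReal.ofReal ((1 + ‖x‖) ^ (-δ)) := by
        rw [polarCoord_target, Measure.volume_eq_prod, setLIntegral_prod]
        exact (((measurable_const.add measurable_fst.norm).pow_const (-δ)).ennreal_ofReal.const_mul
          _).aemeasurable
    _ ≤ ∫⁻ x : ℝ, ENNReal.ofReal (2 ^ δ) * ENNReal.ofReal ((1 + ‖x‖) ^ (-δ)) *
        ENNReal.ofReal (2 * Real.pi) := by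
        refine (setLIntegral_le_lintegral _ _).trans (lintegral_mono fun x => ?_)
        rw [setLIntegral_const, Real.volume_Ioo]
        ring_nf
        rfl
    _ < ∞ := by
        rw [lintegral_mul_const' _ _ ENNReal.ofReal_ne_top,
          lintegral_const_mul' _ _ ENNReal.ofReal_ne_top]
        refine ENNReal.mul_lt_top (ENNReal.mul_lt_top ENNReal.ofReal_lt_top ?_)
          ENNReal.ofReal_lt_top
        exact finite_integral_one_add_norm (by simpa using hδ)

/-- The Cauchy potential of the weight is bounded; this is where `δ > 1` is needed. -/
theorem lintegral_weight_div_dist_le {δ : ℝ} (hδ : 1 < δ) (w : ℂ) :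
    ∫⁻ z, weight δ z * ‖w - z‖ₑ⁻¹ ≤ 2 * ∫⁻ z : ℂ, weight δ z * ‖z‖ₑ⁻¹ := by
  have hm : Measurable fun z : ℂ => weight δ z * ‖z‖ₑ⁻¹ :=
    (measurable_weight δ).mul measurable_enorm.inv
  calc _ ≤ ∫⁻ z, (weight δ z * ‖z‖ₑ⁻¹ + weight δ (z - w) * ‖z - w‖ₑ⁻¹) := by
        refine lintegral_mono fun z => ?_
        simp only
        rw [← ofReal_norm (w - z), norm_sub_rev, ofReal_norm]
        -- The nearer of the two centres `0` and `w` decides: either the kernel at `z - w` is below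
        -- the kernel at `z`, or the weight at `z` is below the weight at `z - w`.
        rcases le_total ‖z‖ ‖z - w‖ with h | h
        · refine le_trans ?_ le_self_add
          gcongr
          exact enorm_le_iff_norm_le.mpr h
        · refine le_trans ?_ le_add_self
          gcongr
          exact weight_mono (by linarith) h
    _ = _ := by
        rw [lintegral_add_left hm, lintegral_sub_right_eq_self
          (fun z => weight δ z * ‖z‖ₑ⁻¹) w, two_mul]

end Gabor

end

/-! ### Local estimates in the Fock space: zeros of density 2 force smallness. -/

noncomputable section

namespace Gabor

open scoped ENNReal Topology ComplexConjugate

/-- The modulus of an entire function relative to `e^{π|z|²/2}`. -/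
def fockMod (G : ℂ → ℂ) (z : ℂ) : ℝ := ‖G z‖ * Real.exp (-(Real.pi * ‖z‖ ^ 2 / 2))

theorem fockMod_nonneg (G : ℂ → ℂ) (z : ℂ) : 0 ≤ fockMod G z :=
  mul_nonneg (norm_nonneg _) (Real.exp_pos _).le

theorem norm_eq_fockMod (G : ℂ → ℂ) (z : ℂ) :
    ‖G z‖ = fockMod G z * Real.exp (Real.pi * ‖z‖ ^ 2 / 2) := by
  rw [fockMod, mul_assoc, ← Real.exp_add]; simp

theorem fockMod_bargmann (g : L2) (z : ℂ) : fockMod (bargmann g) z = ‖gaborTransform g z‖ := by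
  rw [fockMod, norm_gaborTransform, mul_assoc, ← Real.exp_add]; simp

theorem norm_sq_eq_recenter (c z : ℂ) :
    ‖z‖ ^ 2 = ‖z - c‖ ^ 2 + (2 * (conj c * (z - c)).re + ‖c‖ ^ 2) := by
  simp only [Complex.sq_norm, Complex.normSq_apply, Complex.sub_re, Complex.sub_im,
    Complex.mul_re, Complex.conj_re, Complex.conj_im]
  ring

/-- The nonvanishing entire function of modulus `e^{π(|z|² - |z - c|²)/2}`. -/
def recenter (c z : ℂ) : ℂ := Complex.exp (Real.pi * (conj c * (z - c)) + (Real.pi * ‖c‖ ^ 2 / 2 : ℝ))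

theorem norm_recenter (c z : ℂ) :
    ‖recenter c z‖ = Real.exp (Real.pi * ‖z‖ ^ 2 / 2 - Real.pi * ‖z - c‖ ^ 2 / 2) := by
  rw [recenter, Complex.norm_exp, Complex.add_re, Complex.re_ofReal_mul, Complex.ofReal_re,
    norm_sq_eq_recenter c z]
  congr 1; ring

theorem differentiable_recenter (c : ℂ) : Differentiable ℂ (recenter c) := by
  unfold recenter; fun_prop

theorem recenter_ne_zero (c z : ℂ) : recenter c z ≠ 0 := Complex.exp_ne_zero _

/-- The translate of `G` by `c` in the Fock space. -/
def fockTranslate (G : ℂ → ℂ) (c w : ℂ) : ℂ := G (c + w) / recenter c (c + w)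

theorem differentiable_fockTranslate {G : ℂ → ℂ} (hG : Differentiable ℂ G) (c : ℂ) :
    Differentiable ℂ (fockTranslate G c) := by
  have h1 : Differentiable ℂ fun w => G (c + w) := hG.comp (by fun_prop)
  have h2 : Differentiable ℂ fun w => recenter c (c + w) :=
    (differentiable_recenter c).comp (by fun_prop)
  exact h1.div h2 fun w => recenter_ne_zero _ _

theorem norm_fockTranslate (G : ℂ → ℂ) (c w : ℂ) :
    ‖fockTranslate G c w‖ = fockMod G (c + w) * Real.exp (Real.pi * ‖w‖ ^ 2 / 2) := by
  rw [fockTranslate, norm_div, norm_recenter, norm_eq_fockMod, add_sub_cancel_left, mul_div_assoc,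
    ← Real.exp_sub]
  congr 2; ring

theorem continuous_fockMod {G : ℂ → ℂ} (hG : Differentiable ℂ G) : Continuous (fockMod G) := by
  have := hG.continuous
  unfold fockMod; fun_prop

theorem setLIntegral_ball (f : ℂ → ℝ≥0∞) (c : ℂ) (R : ℝ) :
    ∫⁻ w in Metric.ball c R, f w = ∫⁻ w in Metric.ball 0 R, f (c + w) := by
  rw [← lintegral_indicator Metric.isOpen_ball.measurableSet,
    ← lintegral_indicator Metric.isOpen_ball.measurableSet]
  refine (lintegral_add_left_eq_self _ c).symm.trans (lintegral_congr fun w => ?_)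
  by_cases hw : ‖w‖ < R
  · rw [Set.indicator_of_mem (by simpa [mem_ball_iff_norm] using hw),
      Set.indicator_of_mem (by simpa using hw)]
  · rw [Set.indicator_of_notMem (by simpa [mem_ball_iff_norm] using hw),
      Set.indicator_of_notMem (by simpa using hw)]

/-- Translation in the Fock space moves `c` to the origin, where the sub-mean value property
applies; on the unit disc the Gaussian factor is at most `e^{π/2}`. -/
theorem exists_fockMod_sq_le_lintegral_ball : ∃ A : ℝ≥0∞, A ≠ ∞ ∧ ∀ G : ℂ → ℂ,
    Differentiable ℂ G → ∀ c, ‖fockMod G c‖ₑ ^ 2 ≤ A * ∫⁻ w in Metric.ball c 1, ‖fockMod G w‖ₑ ^ 2 := by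
  obtain ⟨A, hA, h⟩ := exists_enorm_sq_le_lintegral_ball
  refine ⟨A * ENNReal.ofReal (Real.exp (Real.pi / 2)) ^ 2, ENNReal.mul_ne_top hA
    (ENNReal.pow_ne_top ENNReal.ofReal_ne_top), fun G hG c => ?_⟩
  have h1 := h _ (differentiable_fockTranslate hG c)
  have h0 : ‖fockTranslate G c 0‖ₑ = ‖fockMod G c‖ₑ := by
    rw [enorm_eq_iff_norm_eq, norm_fockTranslate, Real.norm_of_nonneg (fockMod_nonneg _ _)]
    simp
  rw [h0] at h1
  refine h1.trans ?_
  rw [mul_assoc]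
  gcongr
  rw [setLIntegral_ball _ c, ← lintegral_const_mul' _ _ (ENNReal.pow_ne_top ENNReal.ofReal_ne_top)]
  refine setLIntegral_mono' Metric.isOpen_ball.measurableSet fun w hw => ?_
  rw [← mul_pow]
  gcongr
  rw [← ofReal_norm, norm_fockTranslate, mul_comm, ENNReal.ofReal_mul (Real.exp_pos _).le,
    ← ofReal_norm (fockMod G (c + w)), Real.norm_of_nonneg (fockMod_nonneg _ _)]
  gcongr
  rw [mem_ball_zero_iff] at hw
  have : ‖w‖ ^ 2 ≤ 1 := pow_le_one₀ (norm_nonneg _) hw.le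
  nlinarith [Real.pi_pos]

section

variable {τ : ℂ → ℂ} {Z : Set ℂ} {m c₀ C₀ : ℝ}

/-- Division by a function with simple zeros. -/
theorem IsSigmaLike.exists_quotient (hτ : IsSigmaLike τ Z m c₀ C₀) {G : ℂ → ℂ}
    (hG : Differentiable ℂ G) {Ω : Set ℂ} (h0 : ∀ z ∈ Z ∩ Ω, G z = 0) :
    ∃ h : ℂ → ℂ, DifferentiableOn ℂ h Ω ∧ ∀ z ∈ Ω, G z = τ z * h z := by
  classical
  -- At a zero of `τ` this is the removable value: the quotient agrees nearby with the quotient of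
  -- the two `dslope`s.
  refine ⟨fun z => if τ z = 0 then deriv G z / deriv τ z else G z / τ z, fun z hz => ?_,
    fun z hz => ?_⟩
  · refine DifferentiableAt.differentiableWithinAt ?_
    by_cases hz0 : τ z = 0
    · have hGz : G z = 0 := h0 z ⟨(hτ.eq_zero_iff z).mp hz0, hz⟩
      have hd : ∀ {F : ℂ → ℂ}, Differentiable ℂ F → DifferentiableAt ℂ (dslope F z) z :=
        fun {F} hF => ((Complex.differentiableOn_dslope Filter.univ_mem).mpr
          hF.differentiableOn).differentiableAt Filter.univ_mem
      have hne : dslope τ z z ≠ 0 := by rw [dslope_same]; exact hτ.deriv_ne_zero z hz0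
      refine ((hd hG).div (hd hτ.differentiable) hne).congr_of_eventuallyEq ?_
      filter_upwards [(hd hτ.differentiable).continuousAt.eventually_ne hne] with w hw
      by_cases hwz : w = z
      · subst hwz
        simp [hz0]
      · have e1 : τ w = (w - z) * dslope τ z w := by
          rw [← smul_eq_mul, sub_smul_dslope, hz0, sub_zero]
        have e2 : G w = (w - z) * dslope G z w := by
          rw [← smul_eq_mul, sub_smul_dslope, hGz, sub_zero]
        have e3 : w - z ≠ 0 := sub_ne_zero.mpr hwz
        simp only [Pi.div_apply]
        rw [if_neg (by rw [e1]; exact mul_ne_zero e3 hw), e1, e2, mul_div_mul_left _ _ e3]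
    · refine ((hG z).div (hτ.differentiable z) hz0).congr_of_eventuallyEq ?_
      filter_upwards [(hτ.differentiable z).continuousAt.eventually_ne hz0] with w hw
      simp [hw]
  · by_cases hz0 : τ z = 0
    · rw [hz0, zero_mul, h0 z ⟨(hτ.eq_zero_iff z).mp hz0, hz⟩]
    · simp only [if_neg hz0]
      field_simp

/-- A holomorphic function obeys a bound at a point if it does so nearby, away from a set of
separated points. -/
theorem norm_le_of_separated (hZ : ∀ a ∈ Z, ∀ b ∈ Z, a ≠ b → 1 / 2 ≤ dist a b) {F : ℂ → ℂ}
    {Ω : Set ℂ} (hF : DifferentiableOn ℂ F Ω) {z : ℂ} (hz : Metric.closedBall z (1 / 2) ⊆ Ω)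
    {B : ℝ} (hB : ∀ w ∈ Metric.closedBall z (1 / 2), (∀ a ∈ Z, 1 / 4 ≤ dist w a) → ‖F w‖ ≤ B) :
    ‖F z‖ ≤ B := by
  by_cases h : ∀ a ∈ Z, 1 / 4 ≤ dist z a
  · exact hB z (Metric.mem_closedBall_self (by norm_num)) h
  push Not at h
  obtain ⟨a, ha, haz⟩ := h
  have hsub : Metric.closedBall a (1 / 4) ⊆ Metric.closedBall z (1 / 2) :=
    Metric.closedBall_subset_closedBall' (by rw [dist_comm]; linarith)
  have hd : DiffContOnCl ℂ F (Metric.ball a (1 / 4)) :=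
    (hF.mono (Metric.closure_ball_subset_closedBall.trans (hsub.trans hz))).diffContOnCl
  -- The maximum principle on the disc of radius 1/4 about the offending `a`: its boundary is at
  -- distance 1/4 from `a` and, by separation 1/2, at least 1/4 from the other points of `Z`.
  refine Complex.norm_le_of_forall_mem_frontier_norm_le Metric.isBounded_ball hd (fun w hw => ?_)
    (subset_closure (Metric.mem_ball.mpr haz))
  rw [frontier_ball a (by norm_num), Metric.mem_sphere] at hw
  refine hB w (hsub hw.le) fun b hb => ?_
  by_cases hab : a = b
  · rw [← hab, hw]
  · have := hZ a ha b hb hab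
    have h2 := dist_triangle a w b
    rw [dist_comm a w] at h2
    linarith

/-- For `m = 1` the exponential disappears; for `m = 2` a Gaussian gain `e^{-π|w|²/2}` remains. -/
theorem IsSigmaLike.norm_quotient_le (hτ : IsSigmaLike τ Z m c₀ C₀) {G h : ℂ → ℂ} {w : ℂ} {M : ℝ}
    (hw : G w = τ w * h w) (hM : fockMod G w ≤ M) (hwZ : ∀ a ∈ Z, 1 / 4 ≤ dist w a) :
    ‖h w‖ ≤ M / c₀ * Real.exp ((1 - m) * (Real.pi * ‖w‖ ^ 2 / 2)) := by
  have h1 := hτ.le_norm w hwZ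
  have hc := hτ.pos
  have h2 : ‖τ w‖ * ‖h w‖ ≤ M * Real.exp (Real.pi * ‖w‖ ^ 2 / 2) := by
    rw [← norm_mul, ← hw, norm_eq_fockMod]; gcongr
  have h3 : c₀ * Real.exp (m * (Real.pi * ‖w‖ ^ 2 / 2)) * ‖h w‖ ≤
      M * Real.exp (Real.pi * ‖w‖ ^ 2 / 2) := le_trans (by gcongr) h2
  have h4 : M * Real.exp (Real.pi * ‖w‖ ^ 2 / 2) =
      c₀ * Real.exp (m * (Real.pi * ‖w‖ ^ 2 / 2)) *
        (M / c₀ * Real.exp ((1 - m) * (Real.pi * ‖w‖ ^ 2 / 2))) := by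
    have : Real.exp (Real.pi * ‖w‖ ^ 2 / 2) = Real.exp (m * (Real.pi * ‖w‖ ^ 2 / 2)) *
        Real.exp ((1 - m) * (Real.pi * ‖w‖ ^ 2 / 2)) := by
      rw [← Real.exp_add]; congr 1; ring
    rw [this]; field_simp
  rw [h4] at h3
  exact le_of_mul_le_mul_left h3 (by positivity)

end

/-- A function of the Fock space that vanishes on the lattice of density 2 in a disc is small
inside. -/
theorem exists_fockMod_le_of_vanish : ∃ C : ℝ, 0 ≤ C ∧ ∀ G : ℂ → ℂ, Differentiable ℂ G →
    ∀ (c : ℂ) (ρ M : ℝ), 2 ≤ ρ → (∀ z ∈ (lattice ∪ sharpLattice) ∩ Metric.ball c ρ, G z = 0) →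
    (∀ w ∈ Metric.ball c ρ, fockMod G w ≤ M) → ∀ w, ‖w - c‖ ≤ ρ - 1 →
    fockMod G w ≤ C * M * Real.exp (Real.pi * ‖w - c‖ ^ 2 / 2 - Real.pi * (ρ - 2) ^ 2 / 2) := by
  obtain ⟨c₀, C₀, hτ⟩ := exists_isSigmaLike_sigmaPair
  have hC₀ : 0 ≤ C₀ := by
    have := (norm_nonneg _).trans (hτ.norm_le 0)
    exact nonneg_of_mul_nonneg_left this (Real.exp_pos _)
  have hc₀ := hτ.pos
  refine ⟨C₀ / c₀, by positivity, fun G hG c ρ M hρ h0 hM w hw => ?_⟩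
  obtain ⟨h, hd, hh⟩ := hτ.exists_quotient hG h0
  have hM0 : 0 ≤ M := (fockMod_nonneg G c).trans (hM c (Metric.mem_ball_self (by linarith)))
  set B := M / c₀ * Real.exp (-(Real.pi * (ρ - 2) ^ 2 / 2)) with hBdef
  -- Recentering turns the gain `e^{-π|x|²/2}` of the quotient into `e^{-π|x - c|²/2}`, which is
  -- uniform on circles about `c`. The circle of radius `ρ - 1` leaves room for discs of radius 1/2,
  -- whose points stay outside radius `ρ - 2`.
  set F : ℂ → ℂ := fun z => h z * recenter c z with hF
  have hFd : DifferentiableOn ℂ F (Metric.ball c ρ) :=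
    hd.mul (differentiable_recenter c).differentiableOn
  have hwball : w ∈ Metric.ball c ρ := by rw [mem_ball_iff_norm]; linarith
  have hFw : ‖F w‖ ≤ B := by
    have hr : ρ - 1 ≠ 0 := by linarith
    refine Complex.norm_le_of_forall_mem_frontier_norm_le (U := Metric.ball c (ρ - 1))
      Metric.isBounded_ball (hFd.mono ?_).diffContOnCl (fun v hv => ?_) ?_
    · rw [closure_ball c hr]
      exact Metric.closedBall_subset_ball (by linarith)
    · rw [frontier_ball c hr, mem_sphere_iff_norm] at hv
      have hsub : Metric.closedBall v (1 / 2) ⊆ Metric.ball c ρ := by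
        intro x hx
        rw [mem_closedBall_iff_norm] at hx
        rw [mem_ball_iff_norm]
        have := norm_add_le (x - v) (v - c)
        rw [sub_add_sub_cancel] at this
        linarith
      refine norm_le_of_separated (Z := lattice ∪ sharpLattice)
        (fun a ha b hb => half_le_dist_of_mem_union ha hb) hFd hsub fun x hx hxZ => ?_
      have h1 := hτ.norm_quotient_le (hh x (hsub hx)) (hM x (hsub hx)) hxZ
      have h2 : ρ - 2 ≤ ‖x - c‖ := by
        rw [mem_closedBall_iff_norm] at hx
        have := norm_sub_norm_le (v - c) (v - x)
        rw [norm_sub_rev v x, sub_sub_sub_cancel_left] at this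
        linarith
      calc ‖F x‖ = ‖h x‖ * ‖recenter c x‖ := norm_mul _ _
        _ ≤ M / c₀ * Real.exp ((1 - 2) * (Real.pi * ‖x‖ ^ 2 / 2)) *
            Real.exp (Real.pi * ‖x‖ ^ 2 / 2 - Real.pi * ‖x - c‖ ^ 2 / 2) := by
            rw [norm_recenter]; gcongr
        _ = M / c₀ * Real.exp (-(Real.pi * ‖x - c‖ ^ 2 / 2)) := by
            rw [mul_assoc, ← Real.exp_add]; congr 2; ring
        _ ≤ B := by
            rw [hBdef]
            have : 0 ≤ ρ - 2 := by linarith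
            gcongr
    · rw [closure_ball c hr, mem_closedBall_iff_norm]; exact hw
  have hhw : ‖h w‖ = ‖F w‖ * Real.exp (Real.pi * ‖w - c‖ ^ 2 / 2 - Real.pi * ‖w‖ ^ 2 / 2) := by
    rw [hF, norm_mul, norm_recenter, mul_assoc, ← Real.exp_add]; simp
  rw [fockMod, hh w hwball, norm_mul, hhw]
  calc _ ≤ C₀ * Real.exp (2 * (Real.pi * ‖w‖ ^ 2 / 2)) *
        (B * Real.exp (Real.pi * ‖w - c‖ ^ 2 / 2 - Real.pi * ‖w‖ ^ 2 / 2)) *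
        Real.exp (-(Real.pi * ‖w‖ ^ 2 / 2)) := by
        gcongr
        exact hτ.norm_le w
    _ = C₀ / c₀ * M * (Real.exp (2 * (Real.pi * ‖w‖ ^ 2 / 2)) *
        Real.exp (-(Real.pi * (ρ - 2) ^ 2 / 2)) *
        Real.exp (Real.pi * ‖w - c‖ ^ 2 / 2 - Real.pi * ‖w‖ ^ 2 / 2) *
        Real.exp (-(Real.pi * ‖w‖ ^ 2 / 2))) := by rw [hBdef]; ring
    _ = _ := by
        rw [← Real.exp_add, ← Real.exp_add, ← Real.exp_add]; congr 2; ring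

/-- A form of Hadamard's three circles theorem. -/
theorem norm_sq_le_of_three_circles {H : ℂ → ℂ} (hH : Differentiable ℂ H) {ρ s A B : ℝ}
    (hs0 : 0 < s) (hs : s < 1) (hA : ∀ w, ‖w‖ = s * ρ → ‖H w‖ ≤ A)
    (hB : ∀ w, ‖w‖ = s⁻¹ * ρ → ‖H w‖ ≤ B) {w : ℂ} (hw : ‖w‖ = ρ) : ‖H w‖ ^ 2 ≤ A * B := by
  -- On either boundary circle of the annulus `s < |ξ| < s⁻¹` one factor is bounded by `A` and the
  -- other by `B`; at `ξ = 1` the product is `H(w)²`.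
  set Ψ : ℂ → ℂ := fun ξ => H (w * ξ) * H (w * ξ⁻¹) with hΨ
  set U : Set ℂ := Metric.ball 0 s⁻¹ \ Metric.closedBall 0 s with hU
  have hs1 : 1 < s⁻¹ := (one_lt_inv₀ hs0).mpr hs
  have hUo : IsOpen U := Metric.isOpen_ball.sdiff Metric.isClosed_closedBall
  have hcl : ∀ ξ ∈ closure U, s ≤ ‖ξ‖ ∧ ‖ξ‖ ≤ s⁻¹ := by
    have hc : IsClosed {ξ : ℂ | s ≤ ‖ξ‖ ∧ ‖ξ‖ ≤ s⁻¹} :=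
      (isClosed_le continuous_const continuous_norm).inter
        (isClosed_le continuous_norm continuous_const)
    intro ξ hξ
    refine closure_minimal (fun x hx => ?_) hc hξ
    have h1 := hx.1
    have h2 := hx.2
    rw [mem_ball_zero_iff] at h1
    rw [mem_closedBall_zero_iff, not_le] at h2
    exact ⟨h2.le, h1.le⟩
  have hd : DiffContOnCl ℂ Ψ U := by
    refine DifferentiableOn.diffContOnCl fun ξ hξ => ?_
    have h0 : ξ ≠ 0 := norm_pos_iff.mp (hs0.trans_le (hcl ξ hξ).1)
    refine DifferentiableAt.differentiableWithinAt ?_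
    have h1 : DifferentiableAt ℂ (fun ξ => w * ξ⁻¹) ξ := (differentiableAt_inv h0).const_mul w
    exact ((hH _).comp ξ (by fun_prop)).mul ((hH _).comp ξ h1)
  have h1 : (1 : ℂ) ∈ closure U := subset_closure ⟨by simpa using hs1, by simpa using hs⟩
  have hmain := Complex.norm_le_of_forall_mem_frontier_norm_le
    (Metric.isBounded_ball.subset Set.sdiff_subset) hd (C := A * B) (fun ξ hξ => ?_) h1
  · simpa [hΨ, pow_two] using hmain
  · obtain ⟨hξ1, hξ2⟩ := hcl ξ (frontier_subset_closure hξ)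
    have hA0 : ∀ v, ‖v‖ = s * ρ → ‖H v‖ ≤ A ∧ 0 ≤ A := fun v hv =>
      ⟨hA v hv, (norm_nonneg _).trans (hA v hv)⟩
    rw [hUo.frontier_eq] at hξ
    have hξ' : ‖ξ‖ = s ∨ ‖ξ‖ = s⁻¹ := by
      by_contra hcon
      push Not at hcon
      refine hξ.2 ⟨?_, ?_⟩
      · rw [mem_ball_zero_iff]; exact lt_of_le_of_ne hξ2 hcon.2
      · rw [mem_closedBall_zero_iff, not_le]; exact lt_of_le_of_ne hξ1 hcon.1.symm
    rw [hΨ, norm_mul]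
    rcases hξ' with h | h
    · have e1 : ‖w * ξ‖ = s * ρ := by rw [norm_mul, h, hw, mul_comm]
      have e2 : ‖w * ξ⁻¹‖ = s⁻¹ * ρ := by rw [norm_mul, norm_inv, h, hw, mul_comm]
      exact mul_le_mul (hA _ e1) (hB _ e2) (norm_nonneg _) (hA0 _ e1).2
    · have e1 : ‖w * ξ‖ = s⁻¹ * ρ := by rw [norm_mul, h, hw, mul_comm]
      have e2 : ‖w * ξ⁻¹‖ = s * ρ := by rw [norm_mul, norm_inv, h, hw, inv_inv, mul_comm]
      rw [mul_comm]
      exact mul_le_mul (hA _ e2) (hB _ e1) (norm_nonneg _) (hA0 _ e2).2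

/-- The smallness inside a disc of zeros of density 2 persists on its boundary. -/
theorem exists_fockMod_sq_le_of_vanish : ∃ C : ℝ, 0 ≤ C ∧ ∀ G : ℂ → ℂ, Differentiable ℂ G →
    ∀ (c : ℂ) (ρ M : ℝ), 6 ≤ ρ → (∀ z ∈ (lattice ∪ sharpLattice) ∩ Metric.ball c ρ, G z = 0) →
    (∀ w ∈ Metric.closedBall c (6 / 5 * ρ), fockMod G w ≤ M) → ∀ z, ‖z - c‖ = ρ →
    fockMod G z ^ 2 ≤ C * M ^ 2 * Real.exp (-(Real.pi * ρ ^ 2 / 12) + 2 * Real.pi * ρ) := by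
  obtain ⟨C, hC, h⟩ := exists_fockMod_le_of_vanish
  refine ⟨C, hC, fun G hG c ρ M hρ h0 hM z hz => ?_⟩
  have hM0 : 0 ≤ M :=
    (fockMod_nonneg G c).trans (hM c (Metric.mem_closedBall_self (by linarith)))
  have h1 := h G hG c ρ M (by linarith) h0 fun w hw => hM w
    (Metric.ball_subset_closedBall.trans (Metric.closedBall_subset_closedBall (by linarith)) hw)
  have key := norm_sq_le_of_three_circles (differentiable_fockTranslate hG c) (ρ := ρ)
    -- The inner radius `5ρ/6` is at most `ρ - 1` since `ρ ≥ 6`. The resulting coefficient of `πρ²`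
    -- is `25/36 - 1/2 + 18/25 - 1 = -77/900`, just below `-1/12`.
    (s := 5 / 6)
    (A := C * M * Real.exp (Real.pi * (5 / 6 * ρ) ^ 2 - Real.pi * (ρ - 2) ^ 2 / 2))
    (B := M * Real.exp (Real.pi * (6 / 5 * ρ) ^ 2 / 2)) (by norm_num) (by norm_num)
    (fun w hw => ?_) (fun w hw => ?_) hz
  · rw [norm_fockTranslate, add_sub_cancel, hz, mul_pow, ← Real.exp_nat_mul] at key
    have e : fockMod G z ^ 2 = fockMod G z ^ 2 * Real.exp ((2 : ℕ) * (Real.pi * ρ ^ 2 / 2)) *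
        Real.exp (-(Real.pi * ρ ^ 2)) := by
      rw [mul_assoc, ← Real.exp_add]; push_cast
      rw [show 2 * (Real.pi * ρ ^ 2 / 2) + -(Real.pi * ρ ^ 2) = 0 by ring]; simp
    rw [e]
    calc _ ≤ C * M * Real.exp (Real.pi * (5 / 6 * ρ) ^ 2 - Real.pi * (ρ - 2) ^ 2 / 2) *
          (M * Real.exp (Real.pi * (6 / 5 * ρ) ^ 2 / 2)) * Real.exp (-(Real.pi * ρ ^ 2)) := by
          gcongr
      _ = C * M ^ 2 * (Real.exp (Real.pi * (5 / 6 * ρ) ^ 2 - Real.pi * (ρ - 2) ^ 2 / 2) *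
          Real.exp (Real.pi * (6 / 5 * ρ) ^ 2 / 2) * Real.exp (-(Real.pi * ρ ^ 2))) := by ring
      _ ≤ _ := by
          rw [← Real.exp_add, ← Real.exp_add]
          refine mul_le_mul_of_nonneg_left (Real.exp_le_exp.mpr ?_) (by positivity)
          have : (5 / 6 * ρ) ^ 2 - (ρ - 2) ^ 2 / 2 + (6 / 5 * ρ) ^ 2 / 2 - ρ ^ 2 ≤
              -(ρ ^ 2 / 12) + 2 * ρ := by nlinarith
          nlinarith [Real.pi_pos]
  · rw [norm_fockTranslate]
    have h2 := h1 (c + w) (by rw [add_sub_cancel_left, hw]; linarith)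
    rw [add_sub_cancel_left, hw] at h2
    rw [hw]
    calc _ ≤ C * M * Real.exp (Real.pi * (5 / 6 * ρ) ^ 2 / 2 - Real.pi * (ρ - 2) ^ 2 / 2) *
          Real.exp (Real.pi * (5 / 6 * ρ) ^ 2 / 2) := by gcongr
      _ = _ := by rw [mul_assoc, ← Real.exp_add]; congr 2; ring
  · have hw' : ‖w‖ = 6 / 5 * ρ := by rw [hw]; norm_num
    rw [norm_fockTranslate, hw']
    gcongr
    exact hM _ (by rw [mem_closedBall_iff_norm, add_sub_cancel_left, hw'])

/-- The local estimate on the boundary of a disc of zeros of density 2. -/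
theorem exists_fockMod_sq_le_lintegral : ∃ C : ℝ, 0 ≤ C ∧ ∀ G : ℂ → ℂ, Differentiable ℂ G →
    ∀ (c : ℂ) (ρ : ℝ), 6 ≤ ρ → (∀ z ∈ (lattice ∪ sharpLattice) ∩ Metric.ball c ρ, G z = 0) →
    ∀ z, ‖z - c‖ = ρ → ‖fockMod G z‖ₑ ^ 2 ≤
      ENNReal.ofReal (C * Real.exp (-(Real.pi * ρ ^ 2 / 12) + 2 * Real.pi * ρ)) *
        ∫⁻ w in Metric.ball z (4 * ρ), ‖fockMod G w‖ₑ ^ 2 := by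
  obtain ⟨A, hA, hA'⟩ := exists_fockMod_sq_le_lintegral_ball
  obtain ⟨C, hC, h⟩ := exists_fockMod_sq_le_of_vanish
  -- The added ones make the constant positive, so that an infinite integral on the right makes the
  -- claim trivial.
  refine ⟨(C + 1) * (A.toReal + 1), by positivity, fun G hG c ρ hρ h0 z hz => ?_⟩
  set I := ∫⁻ w in Metric.ball z (4 * ρ), ‖fockMod G w‖ₑ ^ 2 with hI
  set E := Real.exp (-(Real.pi * ρ ^ 2 / 12) + 2 * Real.pi * ρ) with hE
  have hE0 : 0 < E := Real.exp_pos _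
  by_cases hIt : I = ∞
  · rw [hIt, ENNReal.mul_top (ENNReal.ofReal_pos.mpr (by positivity)).ne']
    exact le_top
  have hM : ∀ w ∈ Metric.closedBall c (6 / 5 * ρ), fockMod G w ≤ Real.sqrt (A * I).toReal := by
    intro w hw
    have h1 : ‖fockMod G w‖ₑ ^ 2 ≤ A * I := by
      refine (hA' G hG w).trans ?_
      gcongr
      refine lintegral_mono_set fun x hx => ?_
      rw [mem_closedBall_iff_norm] at hw
      rw [mem_ball_iff_norm] at hx ⊢
      have h2 := norm_add_le (x - w) (w - c)
      have h3 := norm_sub_le (x - c) (z - c)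
      rw [sub_add_sub_cancel] at h2
      rw [sub_sub_sub_cancel_right, hz] at h3
      linarith
    refine Real.le_sqrt_of_sq_le ?_
    rw [← ENNReal.ofReal_le_iff_le_toReal (ENNReal.mul_ne_top hA hIt),
      ENNReal.ofReal_pow (fockMod_nonneg _ _)]
    rwa [← ofReal_norm, Real.norm_of_nonneg (fockMod_nonneg _ _)] at h1
  have h2 := h G hG c ρ _ hρ h0 hM z hz
  rw [Real.sq_sqrt ENNReal.toReal_nonneg] at h2
  rw [← ofReal_norm, Real.norm_of_nonneg (fockMod_nonneg _ _),
    ← ENNReal.ofReal_pow (fockMod_nonneg _ _), ← ENNReal.ofReal_toReal hIt,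
    ← ENNReal.ofReal_mul (by positivity)]
  refine ENNReal.ofReal_le_ofReal (h2.trans ?_)
  rw [ENNReal.toReal_mul]
  calc _ = C * A.toReal * (E * I.toReal) := by ring
    _ ≤ (C + 1) * (A.toReal + 1) * (E * I.toReal) := by gcongr <;> linarith
    _ = _ := by ring

end Gabor

end

/-! ### Little mass in the neighborhood: collar and interior. -/

noncomputable section

namespace Gabor

open scoped ENNReal Topology

/-- By Tonelli each point `w` is counted with the area of the centres `z` whose ball contains it. -/
theorem lintegral_lintegral_ball {f : ℂ → ℝ≥0∞} (hf : Measurable f) (R : ℝ) :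
    ∫⁻ z, ∫⁻ w in Metric.ball z R, f w = volume (Metric.ball (0 : ℂ) R) * ∫⁻ w, f w := by
  simp only [setLIntegral_ball f _ R]
  rw [lintegral_lintegral_swap (by fun_prop)]
  simp only [lintegral_add_right_eq_self f, lintegral_const, Measure.restrict_apply_univ]
  rw [mul_comm]

/-- The factor gained in a disc of radius `r / 8` filled with zeros of density 2. -/
def decay (r : ℝ) : ℝ := Real.exp (-(Real.pi * (r / 8) ^ 2 / 12) + 2 * Real.pi * (r / 8))

/-- Gaussian decay beats the factor `r²` and any exponential rate. The exponents reduce to `3r -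
r²/256`, with maximum 576 at `r = 384`. -/
theorem sq_mul_decay_le {r : ℝ} (hr : 0 ≤ r) :
    r ^ 2 * decay r ≤ 2 * Real.exp 576 * Real.exp (-(2 * r / Real.exp 1)) := by
  have h1 : r ^ 2 ≤ 2 * Real.exp r := by
    have := Real.quadratic_le_exp_of_nonneg hr
    nlinarith
  have h2 : 2 * r / Real.exp 1 ≤ r := by
    rw [div_le_iff₀ (Real.exp_pos _)]
    nlinarith [Real.add_one_le_exp 1]
  calc r ^ 2 * decay r ≤ 2 * Real.exp r * decay r := by
        gcongr
        exact (Real.exp_pos _).le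
    _ = 2 * Real.exp (r + (-(Real.pi * (r / 8) ^ 2 / 12) + 2 * Real.pi * (r / 8))) := by
        rw [Real.exp_add, decay, mul_assoc]
    _ ≤ 2 * Real.exp (576 + -(2 * r / Real.exp 1)) := by
        refine mul_le_mul_of_nonneg_left (Real.exp_le_exp.mpr ?_) zero_le_two
        have h3 : r ^ 2 * 3 ≤ r ^ 2 * Real.pi := by gcongr; exact Real.pi_gt_three.le
        have h4 : r * Real.pi ≤ r * 4 := by gcongr; exact Real.pi_le_four
        nlinarith [sq_nonneg (r - 384)]
    _ = _ := by rw [Real.exp_add, mul_assoc]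

/-- The zeros of a function which is orthogonal to the coherent states of the decomposition. -/
structure Vanishes (G : ℂ → ℂ) (K : Set ℂ) (r : ℝ) : Prop where
  differentiable : Differentiable ℂ G
  lattice : ∀ z ∈ lattice, Metric.infDist z K < r → G z = 0
  sharpLattice : ∀ z ∈ sharpLattice, Metric.infDist z K < r → z ∉ K → G z = 0

/-- Move from `z` by `r/8` towards a point `k` of `K` nearer than `r`. The disc of radius `r/8`
about this centre has `z` on its boundary; its points are nearer than `r` to `k` and nearer than
`r/4` to `z`, so it lies in the neighborhood and misses `K`. All its lattice and sharp points are
therefore zeros. -/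
theorem exists_fockMod_sq_le_of_infDist : ∃ C : ℝ, 0 ≤ C ∧ ∀ (G : ℂ → ℂ) (K : Set ℂ) (r : ℝ),
    K.Nonempty → 100 ≤ r → Vanishes G K r → ∀ z, r / 4 ≤ Metric.infDist z K →
    Metric.infDist z K < r → ‖fockMod G z‖ₑ ^ 2 ≤
      ENNReal.ofReal (C * decay r) * ∫⁻ w in Metric.ball z (r / 2), ‖fockMod G w‖ₑ ^ 2 := by
  obtain ⟨C, hC, h⟩ := exists_fockMod_sq_le_lintegral
  refine ⟨C, hC, fun G K r hK hr hG z hz hz' => ?_⟩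
  obtain ⟨k, hk, hzk⟩ := (Metric.infDist_lt_iff hK).mp hz'
  have hzk' : r / 4 ≤ ‖k - z‖ := by
    rw [← dist_eq_norm, dist_comm]; exact hz.trans (Metric.infDist_le_dist_of_mem hk)
  rw [dist_comm, dist_eq_norm] at hzk
  have hpos : 0 < ‖k - z‖ := by linarith
  set t : ℝ := r / 8 / ‖k - z‖ with ht
  have htn : t * ‖k - z‖ = r / 8 := by rw [ht]; field_simp
  have ht0 : 0 ≤ t := by positivity
  have ht1 : t ≤ 1 := by rw [ht, div_le_one hpos]; linarith
  have hzc : ‖z - (z + t • (k - z))‖ = r / 8 := by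
    rw [sub_add_cancel_left, norm_neg, norm_smul, Real.norm_of_nonneg ht0, htn]
  have hkc : ‖z + t • (k - z) - k‖ = ‖k - z‖ - r / 8 := by
    rw [show z + t • (k - z) - k = (t - 1) • (k - z) by module, norm_smul, Real.norm_eq_abs,
      abs_of_nonpos (by linarith), neg_sub, sub_mul, htn, one_mul]
  have h1 := h G hG.differentiable (z + t • (k - z)) (r / 8) (by linarith) (fun w hw => ?_) z hzc
  · rwa [show 4 * (r / 8) = r / 2 by ring] at h1
  · have hwc := hw.2
    rw [mem_ball_iff_norm] at hwc
    have hwd : Metric.infDist w K < r := by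
      refine (Metric.infDist_lt_iff hK).mpr ⟨k, hk, ?_⟩
      rw [dist_eq_norm]
      have := norm_add_le (w - (z + t • (k - z))) (z + t • (k - z) - k)
      rw [sub_add_sub_cancel] at this
      linarith
    have hwK : w ∉ K := by
      intro hwK
      have h2 := hz.trans (Metric.infDist_le_dist_of_mem hwK)
      rw [dist_eq_norm] at h2
      have := norm_sub_le (z - (z + t • (k - z))) (w - (z + t • (k - z)))
      rw [sub_sub_sub_cancel_right] at this
      linarith
    rcases hw.1 with hl | hl
    · exact hG.lattice w hl hwd
    · exact hG.sharpLattice w hl hwd hwK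

theorem infDist_le_add_norm (K : Set ℂ) (x y : ℂ) :
    Metric.infDist x K ≤ Metric.infDist y K + ‖x - y‖ := by
  rw [← dist_eq_norm]; exact Metric.infDist_le_infDist_add_dist

/-- In the collar, the quotient by `sigma` is as small as the function itself. -/
theorem enorm_quotient_sq_le {c₀ C₀ : ℝ} (hσ : IsSigmaLike sigma lattice 1 c₀ C₀)
    {G h : ℂ → ℂ} {K : Set ℂ} {r : ℝ} {a : ℝ≥0∞} (ha : a ≠ ∞) (hr : 100 ≤ r)
    (hI : ∫⁻ w, ‖fockMod G w‖ₑ ^ 2 ≠ ∞)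
    (hd : DifferentiableOn ℂ h {z | Metric.infDist z K < r})
    (hh : ∀ z, Metric.infDist z K < r → G z = sigma z * h z)
    (hU : ∀ z, r / 4 ≤ Metric.infDist z K → Metric.infDist z K < r →
      ‖fockMod G z‖ₑ ^ 2 ≤ a * ∫⁻ w in Metric.ball z (r / 2), ‖fockMod G w‖ₑ ^ 2)
    {z : ℂ} (h1 : 3 * r / 8 - 1 ≤ Metric.infDist z K) (h2 : Metric.infDist z K ≤ 3 * r / 8 + 1) :
    ‖h z‖ₑ ^ 2 ≤ ENNReal.ofReal (c₀⁻¹ ^ 2) *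
      (a * ∫⁻ w in Metric.ball z r, ‖fockMod G w‖ₑ ^ 2) := by
  set J := a * ∫⁻ w in Metric.ball z r, ‖fockMod G w‖ₑ ^ 2 with hJ
  have hJt : J ≠ ∞ := ENNReal.mul_ne_top ha (ne_top_of_le_ne_top hI (setLIntegral_le_lintegral _ _))
  have hc := hσ.pos
  have hin : ∀ x ∈ Metric.closedBall z (1 / 2), r / 4 ≤ Metric.infDist x K ∧
      Metric.infDist x K < r := by
    intro x hx
    rw [mem_closedBall_iff_norm] at hx
    have h3 := infDist_le_add_norm K x z
    have h4 := infDist_le_add_norm K z x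
    rw [norm_sub_rev] at h4
    constructor <;> linarith
  have hb : ‖h z‖ ≤ Real.sqrt J.toReal / c₀ := by
    refine norm_le_of_separated (Z := lattice) (fun a ha b hb => half_le_dist_of_mem_lattice ha hb)
      hd (fun x hx => (hin x hx).2) fun x hx hxZ => ?_
    have hM : fockMod G x ≤ Real.sqrt J.toReal := by
      refine Real.le_sqrt_of_sq_le ?_
      rw [← ENNReal.ofReal_le_iff_le_toReal hJt, ENNReal.ofReal_pow (fockMod_nonneg _ _)]
      have h5 := hU x (hin x hx).1 (hin x hx).2
      rw [← ofReal_norm, Real.norm_of_nonneg (fockMod_nonneg _ _)] at h5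
      refine h5.trans ?_
      rw [hJ]
      refine mul_le_mul_right (lintegral_mono_set (Metric.ball_subset_ball' ?_)) _
      have := Metric.mem_closedBall.mp hx
      linarith
    simpa using hσ.norm_quotient_le (hh x (hin x hx).2) hM hxZ
  have h6 : ‖h z‖ ^ 2 ≤ c₀⁻¹ ^ 2 * J.toReal := by
    calc _ ≤ (Real.sqrt J.toReal / c₀) ^ 2 := by gcongr
      _ = _ := by rw [div_pow, Real.sq_sqrt ENNReal.toReal_nonneg]; field_simp
  rw [← ofReal_norm, ← ENNReal.ofReal_pow (norm_nonneg _)]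
  refine (ENNReal.ofReal_le_ofReal h6).trans ?_
  rw [ENNReal.ofReal_mul (by positivity), ENNReal.ofReal_toReal hJt]

theorem enorm_fockMod_le {c₀ C₀ : ℝ} (hσ : IsSigmaLike sigma lattice 1 c₀ C₀)
    {G h : ℂ → ℂ} {z : ℂ} (hz : G z = sigma z * h z) :
    ‖fockMod G z‖ₑ ≤ ENNReal.ofReal C₀ * ‖h z‖ₑ := by
  have h1 := hσ.norm_le z
  have hC₀ : 0 ≤ C₀ := nonneg_of_mul_nonneg_left ((norm_nonneg _).trans h1) (Real.exp_pos _)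
  rw [← ofReal_norm, Real.norm_of_nonneg (fockMod_nonneg _ _), ← ofReal_norm,
    ← ENNReal.ofReal_mul hC₀]
  refine ENNReal.ofReal_le_ofReal ?_
  rw [fockMod, hz, norm_mul]
  calc _ ≤ C₀ * Real.exp (1 * (Real.pi * ‖z‖ ^ 2 / 2)) * ‖h z‖ *
        Real.exp (-(Real.pi * ‖z‖ ^ 2 / 2)) := by gcongr
    _ = C₀ * ‖h z‖ * (Real.exp (1 * (Real.pi * ‖z‖ ^ 2 / 2)) *
        Real.exp (-(Real.pi * ‖z‖ ^ 2 / 2))) := by ring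
    _ = _ := by rw [← Real.exp_add]; simp

/-- Integrating in `z` first leaves the potential of the weight, bounded uniformly in `w`; the ball
integrals then contribute only an area. -/
theorem lintegral_mul_weight_div_dist_le {δ : ℝ} (hδ : 1 < δ) {F f : ℂ → ℝ≥0∞}
    (hF : Measurable F) (hf : Measurable f) {b : ℝ≥0∞} (hb : b ≠ ∞) {R : ℝ}
    (h : ∀ w, F w ≤ b * ∫⁻ x in Metric.ball w R, f x) :
    ∫⁻ z, ∫⁻ w, F w * (weight δ z * ‖w - z‖ₑ⁻¹) ≤
      b * (volume (Metric.ball (0 : ℂ) R) * ∫⁻ x, f x) * (2 * ∫⁻ z, weight δ z * ‖z‖ₑ⁻¹) := by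
  have hw := measurable_weight δ
  set W := 2 * ∫⁻ z, weight δ z * ‖z‖ₑ⁻¹ with hW
  have hWt : W ≠ ∞ :=
    ENNReal.mul_ne_top ENNReal.ofNat_ne_top (lintegral_weight_div_norm_lt_top hδ).ne
  calc _ = ∫⁻ w, F w * ∫⁻ z, weight δ z * ‖w - z‖ₑ⁻¹ := by
        rw [lintegral_lintegral_swap (by fun_prop)]
        refine lintegral_congr fun w => ?_
        rw [lintegral_const_mul _ (by fun_prop)]
    _ ≤ ∫⁻ w, b * (∫⁻ x in Metric.ball w R, f x) * W := lintegral_mono fun w =>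
        mul_le_mul' (h w) (lintegral_weight_div_dist_le hδ w)
    _ = _ := by
        rw [lintegral_mul_const' _ _ hWt, lintegral_const_mul' _ _ hb, lintegral_lintegral_ball hf]

/-- The estimate near `K`, where the function is divisible by `sigma`. -/
theorem lintegral_inner_le {c₀ C₀ : ℝ} (hσ : IsSigmaLike sigma lattice 1 c₀ C₀) {B : ℝ}
    (hB : ∀ S : Set ℂ, MeasurableSet S → ∃ χ : ℂ → ℝ, ContDiff ℝ 1 χ ∧
      (∀ z, ‖fderiv ℝ χ z‖ ≤ B) ∧ (∀ z, Metric.ball z 1 ⊆ S → χ z = 1) ∧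
      ∀ z, Disjoint (Metric.ball z 1) S → χ z = 0)
    {δ : ℝ} (hδ : 1 < δ) {G : ℂ → ℂ} {K : Set ℂ} {r : ℝ} {a : ℝ≥0∞} (ha : a ≠ ∞)
    (hK : K.Nonempty) (hKb : Bornology.IsBounded K) (hr : 100 ≤ r) (hG : Vanishes G K r)
    (hI : ∫⁻ w, ‖fockMod G w‖ₑ ^ 2 ≠ ∞)
    (hU : ∀ z, r / 4 ≤ Metric.infDist z K → Metric.infDist z K < r →
      ‖fockMod G z‖ₑ ^ 2 ≤ a * ∫⁻ w in Metric.ball z (r / 2), ‖fockMod G w‖ₑ ^ 2) :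
    ∫⁻ z in {z | Metric.infDist z K < r / 4}, ‖fockMod G z‖ₑ ^ 2 * weight δ z ≤
      ENNReal.ofReal C₀ ^ 2 * (ENNReal.ofReal (c₀⁻¹ ^ 2) * ENNReal.ofReal B *
        (2 * ∫⁻ z, weight δ z * ‖z‖ₑ⁻¹)) *
      (a * (volume (Metric.ball (0 : ℂ) r) * ∫⁻ w, ‖fockMod G w‖ₑ ^ 2)) := by
  have hcont : Continuous fun z : ℂ => Metric.infDist z K := Metric.continuous_infDist_pt K
  set Ω : Set ℂ := {z | Metric.infDist z K < r} with hΩ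
  have hΩo : IsOpen Ω := isOpen_lt hcont continuous_const
  obtain ⟨h, hd, hh⟩ := hσ.exists_quotient hG.differentiable (Ω := Ω)
    fun z hz => hG.lattice z hz.1 hz.2
  -- The level `3r/8` is interior to the collar: as `r ≥ 100`, the gradient of `χ` lives in the
  -- collar with room to spare, and `χ = 1` where the distance to `K` is below `r/4`.
  obtain ⟨χ, hχ, hχB, hχ1, hχ0⟩ := hB {z | Metric.infDist z K < 3 * r / 8}
    (isOpen_lt hcont continuous_const).measurableSet
  have hone : ∀ z, Metric.infDist z K < 3 * r / 8 - 1 → χ z = 1 := fun z hz => hχ1 z fun x hx => by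
    rw [mem_ball_iff_norm] at hx
    have := infDist_le_add_norm K x z
    rw [Set.mem_ofPred_eq]
    linarith
  have hzero : ∀ z, 3 * r / 8 + 1 < Metric.infDist z K → χ z = 0 := fun z hz => hχ0 z <| by
    refine Set.disjoint_left.mpr fun x hx hx' => ?_
    rw [mem_ball_iff_norm, norm_sub_rev] at hx
    have := infDist_le_add_norm K z x
    rw [Set.mem_ofPred_eq] at hx'
    linarith
  have hsub : tsupport χ ⊆ {z | Metric.infDist z K ≤ 3 * r / 8 + 1} := by
    refine closure_minimal (fun z hz => ?_) (isClosed_le hcont continuous_const)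
    by_contra hcon
    exact hz (hzero z (not_le.mp hcon))
  have hsubΩ : tsupport χ ⊆ Ω := fun z hz => by
    have := Set.mem_ofPred_eq ▸ hsub hz
    rw [hΩ, Set.mem_ofPred_eq]
    linarith
  have hcpt : HasCompactSupport χ := by
    refine Metric.isCompact_of_isClosed_isBounded (isClosed_tsupport χ)
      ((hKb.thickening (δ := r)).subset fun z hz => ?_)
    exact (Metric.mem_thickening_iff_infDist_lt hK).mpr (hsubΩ hz)
  have hder : ∀ z, fderiv ℝ χ z ≠ 0 → 3 * r / 8 - 1 ≤ Metric.infDist z K ∧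
      Metric.infDist z K ≤ 3 * r / 8 + 1 := by
    intro z hz
    constructor
    · by_contra hcon
      refine hz ((Filter.EventuallyEq.fderiv_eq (f := fun _ => (1 : ℝ)) ?_).trans (by simp))
      filter_upwards [(isOpen_lt hcont continuous_const).mem_nhds (not_le.mp hcon)] with x hx
        using hone x hx
    · by_contra hcon
      refine hz ((Filter.EventuallyEq.fderiv_eq (f := fun _ => (0 : ℝ)) ?_).trans (by simp))
      filter_upwards [(isOpen_lt continuous_const hcont).mem_nhds (not_le.mp hcon)] with x hx
        using hzero x hx
  -- Working with `h²` rather than `h` makes the Cauchy-Pompeiu inequality linear in the quantities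
  -- to be integrated.
  have hP : DifferentiableOn ℂ (fun z => h z ^ 2) Ω := hd.pow 2
  have hmeas := measurable_enorm_mul_enorm_fderiv hΩo hP hχ hsubΩ
  have hUm : Measurable fun w => ‖fockMod G w‖ₑ ^ 2 := by
    have := (continuous_fockMod hG.differentiable).measurable
    fun_prop
  have hw := measurable_weight δ
  have step1 : ∀ z ∈ {z | Metric.infDist z K < r / 4}, ‖fockMod G z‖ₑ ^ 2 * weight δ z ≤
      ENNReal.ofReal C₀ ^ 2 * ∫⁻ w, ‖h w ^ 2‖ₑ * ‖fderiv ℝ χ w‖ₑ * (weight δ z * ‖w - z‖ₑ⁻¹) := by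
    intro z hz
    rw [Set.mem_ofPred_eq] at hz
    have h1 := enorm_mul_le_lintegral hΩo hP hχ hcpt hsubΩ z
    rw [hone z (by linarith), Complex.ofReal_one, one_mul, enorm_pow] at h1
    calc _ ≤ (ENNReal.ofReal C₀ * ‖h z‖ₑ) ^ 2 * weight δ z := by
          gcongr
          exact enorm_fockMod_le hσ (hh z (by rw [hΩ, Set.mem_ofPred_eq]; linarith))
      _ = ENNReal.ofReal C₀ ^ 2 * (weight δ z * ‖h z‖ₑ ^ 2) := by ring
      _ ≤ ENNReal.ofReal C₀ ^ 2 * (weight δ z *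
          ∫⁻ w, ‖h w ^ 2‖ₑ * ‖fderiv ℝ χ w‖ₑ * ‖w - z‖ₑ⁻¹) := by gcongr
      _ = _ := by
          rw [← lintegral_const_mul _ (by fun_prop)]
          congr 1
          refine lintegral_congr fun w => ?_
          ring
  have step2 : ∀ w, ‖h w ^ 2‖ₑ * ‖fderiv ℝ χ w‖ₑ ≤
      ENNReal.ofReal (c₀⁻¹ ^ 2) * ENNReal.ofReal B *
        a * ∫⁻ x in Metric.ball w r, ‖fockMod G x‖ₑ ^ 2 := by
    intro w
    by_cases hw0 : fderiv ℝ χ w = 0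
    · rw [← ofReal_norm (fderiv ℝ χ w), hw0, norm_zero, ENNReal.ofReal_zero, mul_zero]
      exact zero_le
    obtain ⟨h1, h2⟩ := hder w hw0
    have h3 := enorm_quotient_sq_le hσ ha hr hI hd hh hU h1 h2
    have h4 : ‖fderiv ℝ χ w‖ₑ ≤ ENNReal.ofReal B := by
      rw [← ofReal_norm]; exact ENNReal.ofReal_le_ofReal (hχB w)
    rw [enorm_pow]
    calc _ ≤ _ := mul_le_mul' h3 h4
      _ = _ := by ring
  calc _ ≤ ∫⁻ z in {z | Metric.infDist z K < r / 4}, ENNReal.ofReal C₀ ^ 2 *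
        ∫⁻ w, ‖h w ^ 2‖ₑ * ‖fderiv ℝ χ w‖ₑ * (weight δ z * ‖w - z‖ₑ⁻¹) :=
        setLIntegral_mono' (isOpen_lt hcont continuous_const).measurableSet step1
    _ ≤ ∫⁻ z, ENNReal.ofReal C₀ ^ 2 *
        ∫⁻ w, ‖h w ^ 2‖ₑ * ‖fderiv ℝ χ w‖ₑ * (weight δ z * ‖w - z‖ₑ⁻¹) :=
        setLIntegral_le_lintegral _ _
    _ = ENNReal.ofReal C₀ ^ 2 *
        ∫⁻ z, ∫⁻ w, ‖h w ^ 2‖ₑ * ‖fderiv ℝ χ w‖ₑ * (weight δ z * ‖w - z‖ₑ⁻¹) :=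
        lintegral_const_mul' _ _ (ENNReal.pow_ne_top ENNReal.ofReal_ne_top)
    _ ≤ _ := by
        rw [mul_assoc]
        refine mul_le_mul_right ((lintegral_mul_weight_div_dist_le hδ hmeas hUm (ENNReal.mul_ne_top
          (ENNReal.mul_ne_top ENNReal.ofReal_ne_top ENNReal.ofReal_ne_top) ha) step2).trans ?_) _
        exact le_of_eq (by ring)

/-- The functions of the Fock space with the zeros of `Vanishes` have little mass in the
`r`-neighborhood of `K`. -/
def MassBound (δ C : ℝ) : Prop :=
  ∀ (G : ℂ → ℂ) (K : Set ℂ) (r : ℝ), K.Nonempty → Bornology.IsBounded K → 100 ≤ r →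
    Vanishes G K r → ∫⁻ w, ‖fockMod G w‖ₑ ^ 2 ≠ ∞ →
    ∫⁻ z in Metric.thickening r K, ‖fockMod G z‖ₑ ^ 2 * weight δ z ≤
      ENNReal.ofReal (C * Real.exp (-(2 * r / Real.exp 1))) * ∫⁻ w, ‖fockMod G w‖ₑ ^ 2

/-- The collar and the part near `K` each cost a constant times `decay r` times the area `π r²`. The
weight matters only near `K`; in the collar it is bounded by 1. -/
theorem exists_massBound {δ : ℝ} (hδ : 1 < δ) : ∃ C, 0 ≤ C ∧ MassBound δ C := by
  obtain ⟨c₀, C₀, hσ⟩ := exists_isSigmaLike_sigma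
  obtain ⟨B, hB⟩ := exists_cutoff
  obtain ⟨A, hA, hA'⟩ := exists_fockMod_sq_le_of_infDist
  set M : ℝ≥0∞ := ENNReal.ofReal C₀ ^ 2 * (ENNReal.ofReal (c₀⁻¹ ^ 2) * ENNReal.ofReal B *
    (2 * ∫⁻ z, weight δ z * ‖z‖ₑ⁻¹)) with hM
  have hMt : M ≠ ∞ := ENNReal.mul_ne_top (ENNReal.pow_ne_top ENNReal.ofReal_ne_top)
    (ENNReal.mul_ne_top (ENNReal.mul_ne_top ENNReal.ofReal_ne_top ENNReal.ofReal_ne_top)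
    (ENNReal.mul_ne_top ENNReal.ofNat_ne_top (lintegral_weight_div_norm_lt_top hδ).ne))
  refine ⟨(1 + M.toReal) * A * Real.pi * (2 * Real.exp 576), by positivity,
    fun G K r hK hKb hr hG hI => ?_⟩
  set I := ∫⁻ w, ‖fockMod G w‖ₑ ^ 2 with hIdef
  set a := ENNReal.ofReal (A * decay r) with ha
  have hU := hA' G K r hK hr hG
  have hcont : Continuous fun z : ℂ => Metric.infDist z K := Metric.continuous_infDist_pt K
  have hUm : Measurable fun w => ‖fockMod G w‖ₑ ^ 2 := by
    have := (continuous_fockMod hG.differentiable).measurable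
    fun_prop
  have hinner := lintegral_inner_le hσ hB hδ ENNReal.ofReal_ne_top hK hKb hr hG hI hU
  set T : Set ℂ := {z | Metric.infDist z K < r ∧ r / 4 ≤ Metric.infDist z K} with hT
  have hTm : MeasurableSet T := (isOpen_lt hcont continuous_const).measurableSet.inter
    (isClosed_le continuous_const hcont).measurableSet
  have houter : ∫⁻ z in T, ‖fockMod G z‖ₑ ^ 2 * weight δ z ≤
      a * (volume (Metric.ball (0 : ℂ) r) * I) := by
    calc _ ≤ ∫⁻ z in T, a * ∫⁻ w in Metric.ball z r, ‖fockMod G w‖ₑ ^ 2 := by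
          refine setLIntegral_mono' hTm fun z hz => ?_
          calc _ ≤ ‖fockMod G z‖ₑ ^ 2 * 1 := by gcongr; exact weight_le_one z
            _ ≤ _ := by
              rw [mul_one]
              refine (hU z hz.2 hz.1).trans (mul_le_mul_right (lintegral_mono_set
                (Metric.ball_subset_ball (by linarith))) _)
      _ ≤ ∫⁻ z, a * ∫⁻ w in Metric.ball z r, ‖fockMod G w‖ₑ ^ 2 := setLIntegral_le_lintegral _ _
      _ = _ := by
          rw [lintegral_const_mul' _ _ ENNReal.ofReal_ne_top, lintegral_lintegral_ball hUm]
  have hcover : Metric.thickening r K ⊆ {z | Metric.infDist z K < r / 4} ∪ T := by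
    intro z hz
    rw [Metric.mem_thickening_iff_infDist_lt hK] at hz
    rcases lt_or_ge (Metric.infDist z K) (r / 4) with h | h
    · exact Or.inl h
    · exact Or.inr ⟨hz, h⟩
  have hvol : volume (Metric.ball (0 : ℂ) r) = ENNReal.ofReal (r ^ 2 * Real.pi) := by
    rw [Complex.volume_ball, ENNReal.ofReal_mul (by positivity),
      ENNReal.ofReal_pow (by linarith), ← NNReal.coe_real_pi, ENNReal.ofReal_coe_nnreal]
  calc _ ≤ _ := lintegral_mono_set hcover
    _ ≤ _ := lintegral_union_le _ _ _
    _ ≤ M * (a * (volume (Metric.ball (0 : ℂ) r) * I)) +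
        a * (volume (Metric.ball (0 : ℂ) r) * I) := add_le_add hinner houter
    _ = (1 + M) * (a * volume (Metric.ball (0 : ℂ) r)) * I := by
        clear_value M I a
        ring
    _ = ENNReal.ofReal ((1 + M.toReal) * (A * decay r * (r ^ 2 * Real.pi))) * I := by
        have hd : 0 ≤ decay r := (Real.exp_pos _).le
        rw [hvol, ha, ← ENNReal.ofReal_mul (by positivity),
          ENNReal.ofReal_mul (p := 1 + M.toReal) (by positivity),
          ENNReal.ofReal_add zero_le_one ENNReal.toReal_nonneg, ENNReal.ofReal_one,
          ENNReal.ofReal_toReal hMt]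
    _ ≤ _ := by
        refine mul_le_mul_left (ENNReal.ofReal_le_ofReal ?_) _
        have h1 := sq_mul_decay_le (show 0 ≤ r by linarith)
        calc _ = (1 + M.toReal) * A * Real.pi * (r ^ 2 * decay r) := by ring
          _ ≤ (1 + M.toReal) * A * Real.pi *
              (2 * Real.exp 576 * Real.exp (-(2 * r / Real.exp 1))) := by gcongr
          _ = _ := by ring

end Gabor

end

/-! ### Orthogonal projection and the estimate of the remainder by duality. -/

noncomputable section

namespace Gabor

open scoped ENNReal ComplexConjugate

theorem lintegral_mul_le_ofReal_sqrt {μ : Measure ℂ} {a b : ℂ → ℝ≥0∞} (ha : AEMeasurable a μ)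
    (hb : AEMeasurable b μ) {α β : ℝ} (hα : 0 ≤ α) (hβ : 0 ≤ β)
    (h1 : ∫⁻ z, a z ^ 2 ∂μ ≤ ENNReal.ofReal α) (h2 : ∫⁻ z, b z ^ 2 ∂μ ≤ ENNReal.ofReal β) :
    ∫⁻ z, a z * b z ∂μ ≤ ENNReal.ofReal (Real.sqrt α * Real.sqrt β) := by
  have aux : ∀ {x : ℝ≥0∞} {y : ℝ}, 0 ≤ y → x ≤ ENNReal.ofReal y →
      x ^ (1 / 2 : ℝ) ≤ ENNReal.ofReal (Real.sqrt y) := fun {x y} hy hx => by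
    rw [Real.sqrt_eq_rpow, ← ENNReal.ofReal_rpow_of_nonneg hy (by norm_num)]
    gcongr
  have h := ENNReal.lintegral_mul_le_Lp_mul_Lq μ Real.HolderConjugate.two_two ha hb
  simp only [Pi.mul_apply, ENNReal.rpow_two] at h
  rw [ENNReal.ofReal_mul (Real.sqrt_nonneg _)]
  exact h.trans (mul_le_mul' (aux hα h1) (aux hβ h2))

theorem exists_eq_finsum_of_mem_span {S : Set ℂ} (hS : S.Finite) {v : ℂ → L2} {x : L2}
    (hx : x ∈ Submodule.span ℂ (v '' S)) : ∃ α : ℂ → ℂ, x = ∑ᶠ z ∈ S, α z • v z := by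
  rw [← hS.coe_toFinset, Submodule.mem_span_image_finset_iff_exists_fun'] at hx
  obtain ⟨α, hα⟩ := hx
  exact ⟨α, by rw [finsum_mem_eq_finite_toFinset_sum _ hS, hα]⟩

/-- The orthogonal projection onto the span of two finite families of coherent states. -/
theorem exists_orthogonal_decomposition {S T : Set ℂ} (hS : S.Finite) (hT : T.Finite) (f : L2) :
    ∃ (α ω : ℂ → ℂ) (φ : L2), f = (∑ᶠ z ∈ S, α z • coherent z) +
      (∑ᶠ z ∈ T, ω z • coherent z) + φ ∧ (∀ z ∈ S ∪ T, gaborTransform φ z = 0) ∧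
      inner ℂ φ f = (‖φ‖ : ℂ) ^ 2 := by
  set V : Submodule ℂ L2 := Submodule.span ℂ (coherent '' S) ⊔ Submodule.span ℂ (coherent '' T)
    with hV
  have hV' : V = Submodule.span ℂ (coherent '' (S ∪ T)) := by
    rw [hV, ← Submodule.span_union, Set.image_union]
  have hfin : FiniteDimensional ℂ V := by
    rw [hV']; exact FiniteDimensional.span_of_finite ℂ ((hS.union hT).image _)
  have hmem := V.starProjection_apply_mem f
  have horth := V.sub_starProjection_mem_orthogonal f
  set p := V.starProjection f with hp
  rw [Submodule.mem_orthogonal] at horth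
  obtain ⟨x, hx, y, hy, hxy⟩ := Submodule.mem_sup.mp hmem
  obtain ⟨α, hα⟩ := exists_eq_finsum_of_mem_span hS hx
  obtain ⟨ω, hω⟩ := exists_eq_finsum_of_mem_span hT hy
  refine ⟨α, ω, f - p, ?_, fun z hz => ?_, ?_⟩
  · rw [← hα, ← hω, hxy, add_sub_cancel]
  · refine horth _ ?_
    rw [hV']
    exact Submodule.subset_span (Set.mem_image_of_mem _ hz)
  · have h1 : inner ℂ (f - p) p = (0 : ℂ) := inner_eq_zero_symm.mp (horth p hmem)
    have h2 : inner ℂ (f - p) f = inner ℂ (f - p) (f - p) + inner ℂ (f - p) p := by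
      rw [← inner_add_right, sub_add_cancel]
    rw [h2, h1, add_zero, inner_self_eq_norm_sq_to_K]
    rfl

theorem enorm_inner_le_lintegral (f g : L2) (D : Set ℂ) (hD : MeasurableSet D) :
    ‖(inner ℂ g f : ℂ)‖ₑ ≤ (∫⁻ z in Dᶜ, ‖gaborTransform f z‖ₑ * ‖gaborTransform g z‖ₑ) +
      ∫⁻ z in D, ‖gaborTransform f z‖ₑ * ‖gaborTransform g z‖ₑ := by
  rw [inner_eq_integral_gaborTransform, add_comm, lintegral_add_compl _ hD]
  refine (enorm_integral_le_lintegral_enorm _).trans (le_of_eq (lintegral_congr fun z => ?_))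
  rw [enorm_mul]
  congr 1
  exact RCLike.enorm_conj _

theorem lintegral_enorm_sq_eq_ofReal {E : Type*} [NormedAddCommGroup E] {μ : Measure ℂ}
    {F : ℂ → E} (hF : Integrable (fun z => ‖F z‖ ^ 2) μ) :
    ∫⁻ z, ‖F z‖ₑ ^ 2 ∂μ = ENNReal.ofReal (∫ z, ‖F z‖ ^ 2 ∂μ) := by
  rw [ofReal_integral_eq_lintegral_ofReal hF (Filter.Eventually.of_forall fun z => by positivity)]
  refine lintegral_congr fun z => ?_
  rw [← ofReal_norm, ENNReal.ofReal_pow (norm_nonneg _)]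

/-- The remainder of the orthogonal projection is small. -/
theorem norm_le_of_orthogonal {C δ r : ℝ} {K : Set ℂ} (hC : 0 ≤ C)
    (hmass : MassBound δ C)
    (hK : K.Nonempty) (hKb : Bornology.IsBounded K) (hr : 100 ≤ r) {f φ : L2}
    (hf : MemH δ f) (hφ : Vanishes (bargmann φ) K r) (hφf : inner ℂ φ f = (‖φ‖ : ℂ) ^ 2) :
    ‖φ‖ ≤ Real.sqrt (∫ z in (Metric.thickening r K)ᶜ, ‖gaborTransform f z‖ ^ 2) +
      Real.sqrt C * Real.exp (-r / Real.exp 1) * normH δ f := by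
  set D := Metric.thickening r K with hD
  have hDm : MeasurableSet D := Metric.isOpen_thickening.measurableSet
  have hm : ∀ g : L2, Measurable (gaborTransform g) := fun g =>
    (continuous_gaborTransform g).measurable
  have hint : ∀ g : L2, Integrable fun z => ‖gaborTransform g z‖ ^ 2 := fun g =>
    (memLp_gaborTransform g).integrable_norm_pow two_ne_zero
  have hφ2 : ∫⁻ z, ‖gaborTransform φ z‖ₑ ^ 2 = ENNReal.ofReal (‖φ‖ ^ 2) := by
    rw [lintegral_enorm_gaborTransform_sq, ← ofReal_norm, ENNReal.ofReal_pow (norm_nonneg _)]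
  have hmod : ∀ z, ‖fockMod (bargmann φ) z‖ₑ = ‖gaborTransform φ z‖ₑ := fun z => by
    rw [fockMod_bargmann, enorm_norm]
  have hpos : ∀ z : ℂ, 0 < ‖z‖ ^ δ + 1 := fun z => by positivity
  have h1 : ∫⁻ z in Dᶜ, ‖gaborTransform f z‖ₑ * ‖gaborTransform φ z‖ₑ ≤ ENNReal.ofReal
      (Real.sqrt (∫ z in Dᶜ, ‖gaborTransform f z‖ ^ 2) * Real.sqrt (‖φ‖ ^ 2)) := by
    refine lintegral_mul_le_ofReal_sqrt (hm f).enorm.aemeasurable (hm φ).enorm.aemeasurable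
      (integral_nonneg fun z => by positivity) (by positivity)
      (lintegral_enorm_sq_eq_ofReal (hint f).integrableOn).le
      ((setLIntegral_le_lintegral _ _).trans hφ2.le)
  have h2 : ∫⁻ z in D, ‖gaborTransform f z‖ₑ * ‖gaborTransform φ z‖ₑ ≤ ENNReal.ofReal
      (normH δ f * Real.sqrt (C * Real.exp (-(2 * r / Real.exp 1)) * ‖φ‖ ^ 2)) := by
    have hs : Measurable fun z : ℂ => ENNReal.ofReal (Real.sqrt (‖z‖ ^ δ + 1)) := by
      have : Measurable fun z : ℂ => ‖z‖ ^ δ := measurable_norm.pow_const δ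
      fun_prop
    have hs0 : ∀ z : ℂ, ENNReal.ofReal (Real.sqrt (‖z‖ ^ δ + 1)) ≠ 0 := fun z =>
      (ENNReal.ofReal_pos.mpr (Real.sqrt_pos.mpr (hpos z))).ne'
    have hsq : ∀ z : ℂ, ENNReal.ofReal (Real.sqrt (‖z‖ ^ δ + 1)) ^ 2 =
        ENNReal.ofReal (‖z‖ ^ δ + 1) := fun z => by
      rw [← ENNReal.ofReal_pow (Real.sqrt_nonneg _), Real.sq_sqrt (hpos z).le]
    -- The square root of `|z|^δ + 1` goes to `f`, giving `normH δ f`, and its inverse to `φ`,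
    -- giving the integral controlled by `MassBound`.
    calc _ = ∫⁻ z in D, (ENNReal.ofReal (Real.sqrt (‖z‖ ^ δ + 1)) * ‖gaborTransform f z‖ₑ) *
          ((ENNReal.ofReal (Real.sqrt (‖z‖ ^ δ + 1)))⁻¹ * ‖gaborTransform φ z‖ₑ) := by
          refine lintegral_congr fun z => ?_
          rw [mul_mul_mul_comm, ENNReal.mul_inv_cancel (hs0 z) ENNReal.ofReal_ne_top, one_mul]
      _ ≤ _ := by
          refine lintegral_mul_le_ofReal_sqrt (hs.mul (hm f).enorm).aemeasurable
            (hs.inv.mul (hm φ).enorm).aemeasurable (integral_nonneg fun z => ?_) (by positivity)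
            ((setLIntegral_le_lintegral _ _).trans (le_of_eq ?_)) ?_
          · have := hpos z
            positivity
          · rw [ofReal_integral_eq_lintegral_ofReal hf
              (Filter.Eventually.of_forall fun z => by have := hpos z; positivity)]
            refine lintegral_congr fun z => ?_
            rw [Pi.mul_apply, mul_pow, hsq, ENNReal.ofReal_mul (hpos z).le, ← ofReal_norm (gaborTransform f z),
              ENNReal.ofReal_pow (norm_nonneg _)]
          · have h3 := hmass _ K r hK hKb hr hφ (by simp only [hmod]; rw [hφ2]; simp)
            simp only [hmod] at h3
            rw [hφ2, ← ENNReal.ofReal_mul (by positivity)] at h3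
            refine le_trans (le_of_eq (lintegral_congr fun z => ?_)) h3
            rw [Pi.mul_apply, Pi.inv_apply, mul_pow, ← ENNReal.inv_pow, hsq, mul_comm]
            rfl
  have hN : 0 ≤ normH δ f := Real.sqrt_nonneg _
  have hsqrt : Real.sqrt (C * Real.exp (-(2 * r / Real.exp 1)) * ‖φ‖ ^ 2) =
      Real.sqrt C * Real.exp (-r / Real.exp 1) * ‖φ‖ := by
    rw [Real.sqrt_mul (by positivity), Real.sqrt_mul hC, Real.sqrt_sq (norm_nonneg _),
      show -(2 * r / Real.exp 1) = -r / Real.exp 1 + -r / Real.exp 1 by ring, Real.exp_add,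
      Real.sqrt_mul_self (Real.exp_pos _).le]
  have h3 := (enorm_inner_le_lintegral f φ D hDm).trans (add_le_add h1 h2)
  rw [hφf, hsqrt, Real.sqrt_sq (norm_nonneg _),
    ← ENNReal.ofReal_add (by positivity) (by positivity), ← ofReal_norm,
    ENNReal.ofReal_le_ofReal_iff (by positivity), norm_pow, Complex.norm_real, norm_norm] at h3
  -- The inequality so far bounds `‖φ‖²` by the claimed bound times `‖φ‖`.
  rcases (norm_nonneg φ).eq_or_lt with h0 | h0
  · rw [← h0]; positivity
  · refine le_of_mul_le_mul_right ?_ h0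
    linarith

theorem vanishes_bargmann {K : Set ℂ} {r : ℝ} (hK : K.Nonempty) {φ : L2}
    (h : ∀ z ∈ lattice ∩ Metric.thickening r K ∪ sharpLattice ∩ (Metric.thickening r K \ K),
      gaborTransform φ z = 0) : Vanishes (bargmann φ) K r := by
  have h0 : ∀ z, gaborTransform φ z = 0 → bargmann φ z = 0 := fun z hz => by
    rw [← norm_eq_zero, norm_gaborTransform, hz, norm_zero, zero_mul]
  refine ⟨differentiable_bargmann φ, fun z hz hzr => h0 z (h z (Or.inl ⟨hz, ?_⟩)),
    fun z hz hzr hzK => h0 z (h z (Or.inr ⟨hz, ?_, hzK⟩))⟩ <;>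
  exact (Metric.mem_thickening_iff_infDist_lt hK).mpr hzr

end Gabor

end

/-! ### The certainty theorem. -/

theorem mainTheorem5 :
    ∃ r₀ : ℝ, 0 < r₀ ∧ ∃ C : ℝ → ℝ,
      ∀ (K D : Set Gabor.Phase) (r : ℝ),
        IsOpen K → IsConnected K → Bornology.IsBounded K →
        r₀ ≤ r → D = Metric.thickening r K →
        ∀ f : Gabor.L2, (∃ δ : ℝ, 1 < δ ∧ Gabor.MemH δ f) →
          ∃ (α ω : Gabor.Phase → ℂ) (φ : Gabor.L2),
            f = (∑ᶠ z ∈ Gabor.lattice ∩ D, α z • Gabor.coherent z) +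
                (∑ᶠ z ∈ Gabor.sharpLattice ∩ (D \ K), ω z • Gabor.coherent z) + φ ∧
            ∀ δ : ℝ, 1 < δ → Gabor.MemH δ f →
              ‖φ‖ ≤ Real.sqrt (∫ z in Dᶜ, ‖Gabor.gaborTransform f z‖ ^ 2) +
                C δ * r ^ δ * Real.exp (-r / Real.exp 1) * Gabor.normH δ f := by
  have hex : ∀ δ : ℝ, ∃ C, 0 ≤ C ∧ (1 < δ → Gabor.MassBound δ C) := fun δ => by
    by_cases hδ : 1 < δ
    · obtain ⟨C, hC, h⟩ := Gabor.exists_massBound hδ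
      exact ⟨C, hC, fun _ => h⟩
    -- An arbitrary value: the bound is claimed only for `δ > 1`.
    · exact ⟨0, le_rfl, fun h => absurd h hδ⟩
  choose C hC using hex
  refine ⟨100, by norm_num, fun δ => Real.sqrt (C δ), ?_⟩
  intro K D r _ hKc hKb hr hD f _
  subst hD
  have hDb : Bornology.IsBounded (Metric.thickening r K) := hKb.thickening
  -- The projection does not involve `δ`, so one decomposition serves every `δ` with `f` in `H^δ`.
  obtain ⟨α, ω, φ, hf, h0, hφ⟩ := Gabor.exists_orthogonal_decomposition
    (Gabor.finite_lattice_inter hDb)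
    (Gabor.finite_sharpLattice_inter (hDb.subset (Set.sdiff_subset (t := K)))) f
  refine ⟨α, ω, φ, hf, fun δ hδ hfδ => ?_⟩
  refine (Gabor.norm_le_of_orthogonal (hC δ).1 ((hC δ).2 hδ) hKc.nonempty hKb hr hfδ
    (Gabor.vanishes_bargmann hKc.nonempty h0) hφ).trans ?_
  -- The estimate already holds without the factor `r^δ`, which is at least 1 here.
  have h1 : 1 ≤ r ^ δ := Real.one_le_rpow (by linarith) (by linarith)
  have h2 : 0 ≤ Gabor.normH δ f := Real.sqrt_nonneg _
  gcongr
  exact le_mul_of_one_le_right (Real.sqrt_nonneg _) h1
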